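/- **Setting.** A stochastic shortest path problem (SSP) $\mathcal M$ has $S$ non-goal states, $A$ actions, an absorbing cost-free goal state $g$, deterministic costs $c(s,a)\in[0,1]$ and transition laws $P(\cdot\mid s,a)$ on states and goal. For a stationary (possibly randomized) policy $\pi$, $V^\pi(s)\in[0,\infty]$ is the expected total cost and $T^\pi(s)\in[0,\infty]$ the expected number of steps to reach $g$ from $s$; $\pi$ is proper if $T^\pi(s)<\infty$ for all $s$. Put $V^\star(s)=\inf_{\pi\text{ proper}}V^\pi(s)$, $B_\star=\max_sV^\star(s)$, $c_{\min}=\min_{s,a}c(s,a)$ and $T_\ddagger=B_\star/c_{\min}$. For $T>0$ let $\Pi_T=\{\pi:\max_sT^\pi(s)\le T\}$, $V^{\star,T}(s)=\inf_{\pi\in\Pi_T}V^\pi(s)$ ($=\infty$ if $\Pi_T=\varnothing$) and $B_{\star,T}=\max_sV^{\star,T}(s)$. A policy $\pi$ is $(\epsilon,T)$-optimal if $V^\pi(s)\le V^{\star,T}(s)+\epsilon$ for all $s$. A learner with a generative model is a randomized algorithm that knows $S$, $A$ and the cost function, adaptively chooses state-action pairs $(s,a)$, observes for each an independent next state drawn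 from $P(\cdot\mid s,a)$, may stop after a random number $\tau$ of samples, and then returns a stationary policy $\hat\pi$. It is $(\epsilon,\delta,T)$-correct if $\mathbb P_{\mathcal M}(\tau<\infty\text{ and }\hat\pi\text{ is }(\epsilon,T)\text{-optimal})\ge1-\delta$ for every SSP $\mathcal M$ with $S$ states and $A$ actions that has a proper policy (so no finite bound $\overline T$ on the hitting time of the optimal policy is known: $\overline T=\infty$). It has sample complexity at most $n$ on $\mathcal M$ if $\mathbb P_{\mathcal M}(\tau\le n)\ge1-\delta$. **Theorem.** There is a universal constant $c>0$ such that the following holds. Let $S,A\in\mathbb N$ and let $B,B_T,T$ be real with $$1\le B\le B_T,\qquad 2\le B_T\le\tfrac14\,B\,(A-1)^{\lceil S/2\rceil-1},\qquad T\ge 6B_T,$$ and let $\epsilon\in(0,\tfrac1{32})$ and $\delta\in(0,\tfrac1{8e^4})$. For every $(\epsilon,\delta,T)$-correct learner there is an SSP $\mathcal M$ with $S$ states and $A$ actions that has a proper policy and satisfies $c_{\min}=0$, $B_\star=B$ (hence $T_\ddagger=\infty$ and $\min\{T_\ddagger,\overline T\}=\infty$) and $\tfrac12B_T\le B_{\star,T}\le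 3B_T$, such that every $n\in\mathbb N$ for which the learner has sample complexity at most $n$ on $\mathcal M$ satisfies $$n\ \ge\ c\,\frac{T\,B_{\star,T}^2\,S\,A}{\epsilon^2}\,\ln\frac1\delta .$$ -/

import Mathlib

open scoped NNReal ENNReal

/-- A stochastic shortest path problem with `S` (non-goal) states and `A` actions. The extended
state space is `Option (Fin S)`, where `none` is the goal state: it is absorbing and free of cost.
Costs lie in `[0, 1]` and are incurred deterministically; `trans s a` is the law of the next
state. -/
structure SSP (S A : ℕ) where
  cost : Fin S → Fin A → ℝ≥0
  cost_le_one : ∀ s a, cost s a ≤ 1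
  trans : Fin S → Fin A → stdSimplex ℝ≥0 (Option (Fin S))

/-- Stationary, possibly randomized policies: `π s a` is the probability of action `a` in
state `s`. -/
abbrev Policy (S A : ℕ) : Type := Fin S → stdSimplex ℝ≥0 (Fin A)

namespace SSP

variable {S A : ℕ}

/-- One-step transition probabilities of the Markov chain on `Option (Fin S)` induced by `π`. -/
def step (M : SSP S A) (π : Policy S A) : Option (Fin S) → Option (Fin S) → ℝ≥0
  | none, y => if y = none then 1 else 0
  | some s, y => ∑ a, π s a * M.trans s a y

/-- `M.stateLaw π s t y` is the probability to be in `y` after `t` steps of `π` started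
from `s`. -/
def stateLaw (M : SSP S A) (π : Policy S A) (s : Fin S) : ℕ → Option (Fin S) → ℝ≥0
  | 0, y => if y = some s then 1 else 0
  | t + 1, y => ∑ x, M.stateLaw π s t x * M.step π x y

/-- The value `V^π(s)`: the expected total cost of `π` from `s`, i.e. the sum over all time steps
`t` of the expected cost incurred at time `t` (no cost is incurred at the goal). -/
noncomputable def value (M : SSP S A) (π : Policy S A) (s : Fin S) : ℝ≥0∞ :=
  ∑' t : ℕ, ∑ x : Fin S, ((M.stateLaw π s t (some x) * ∑ a, π x a * M.cost x a : ℝ≥0) : ℝ≥0∞)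

/-- The hitting time `T^π(s)`: the expected number of steps that `π` needs from `s` to reach the
goal, i.e. the sum over `t` of the probability that the goal is not reached by time `t`. -/
noncomputable def hitting (M : SSP S A) (π : Policy S A) (s : Fin S) : ℝ≥0∞ :=
  ∑' t : ℕ, ∑ x : Fin S, (M.stateLaw π s t (some x) : ℝ≥0∞)

/-- A policy is proper if its expected hitting time is finite from every state. -/
def IsProper (M : SSP S A) (π : Policy S A) : Prop := ∀ s, M.hitting π s < ∞

/-- `Π_T`: the policies with expected hitting time at most `T` from every state. -/
def boundedPolicies (M : SSP S A) (T : ℝ) : Set (Policy S A) :=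
  {π | ∀ s, M.hitting π s ≤ ENNReal.ofReal T}

/-- `V⋆(s)`: the optimal value over proper policies. -/
noncomputable def optValue (M : SSP S A) (s : Fin S) : ℝ≥0∞ :=
  ⨅ π ∈ {π | M.IsProper π}, M.value π s

/-- `V^{⋆,T}(s)`: the optimal value over `Π_T` (it is `∞` if `Π_T` is empty). -/
noncomputable def optValueT (M : SSP S A) (T : ℝ) (s : Fin S) : ℝ≥0∞ :=
  ⨅ π ∈ M.boundedPolicies T, M.value π s

/-- `B⋆ = max_s V⋆(s)`. -/
noncomputable def Bstar (M : SSP S A) : ℝ≥0∞ := ⨆ s, M.optValue s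

/-- `B_{⋆,T} = max_s V^{⋆,T}(s)`. -/
noncomputable def BstarT (M : SSP S A) (T : ℝ) : ℝ≥0∞ := ⨆ s, M.optValueT T s

/-- `c_min`: the minimum cost over all state-action pairs. -/
noncomputable def cmin (M : SSP S A) : ℝ≥0 := ⨅ s, ⨅ a, M.cost s a

/-- `T‡ = B⋆ / c_min`. -/
noncomputable def Tddagger (M : SSP S A) : ℝ≥0∞ := M.Bstar / (M.cmin : ℝ≥0∞)

/-- `(ε, T)`-optimality: `V^π(s) ≤ V^{⋆,T}(s) + ε` for all `s`. There is no constraint on the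
hitting time of `π` itself. -/
def IsOptimalT (M : SSP S A) (ε T : ℝ) (π : Policy S A) : Prop :=
  ∀ s, M.value π s ≤ M.optValueT T s + ENNReal.ofReal ε

end SSP

/-- Interaction history with the generative model: the list of queried pairs `(s, a)` and sampled
next states `s'`, oldest first. -/
abbrev History (S A : ℕ) : Type := List ((Fin S × Fin A) × Option (Fin S))

/-- A (randomized, adaptive) learning algorithm with a generative model. It knows the cost function.
Given the history so far, `choose` is the law of its next decision: `some (s, a)` means that the
next state of `(s, a)` is sampled once more, `none` means that it stops; when it stops, its returned
policy is drawn from `output`. -/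
structure Learner (S A : ℕ) where
  choose : (Fin S → Fin A → ℝ≥0) → History S A → stdSimplex ℝ≥0 (Option (Fin S × Fin A))
  output : (Fin S → Fin A → ℝ≥0) → History S A →
    MeasureTheory.ProbabilityMeasure (Policy S A)

namespace Learner

open MeasureTheory

variable {S A : ℕ}

/-- `L.outputLawFrom M n h` is the law of the policy returned by `L`, run on `M` from the history
`h` on, restricted to the event that `L` stops after at most `n` further samples. -/
noncomputable def outputLawFrom (L : Learner S A) (M : SSP S A) :
    ℕ → History S A → Measure (Policy S A)
  | 0, h => L.choose M.cost h none • (L.output M.cost h : Measure (Policy S A))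
  | n + 1, h => L.choose M.cost h none • (L.output M.cost h : Measure (Policy S A)) +
      ∑ q : Fin S × Fin A, L.choose M.cost h (some q) •
        ∑ y : Option (Fin S), M.trans q.1 q.2 y • L.outputLawFrom M n (h ++ [(q, y)])

/-- The law of the returned policy on the event that `L`, run on `M`, uses at most `n` samples:
with `τ` the number of samples used and `π̂` the returned policy, `L.outputLaw M n E` is
`ℙ_M(τ ≤ n, π̂ ∈ E)`. -/
noncomputable def outputLaw (L : Learner S A) (M : SSP S A) (n : ℕ) : Measure (Policy S A) :=
  L.outputLawFrom M n []

/-- `(ε, δ, T)`-correctness: on every SSP with `S` states and `A` actions that has a proper policy,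
`L` stops and returns an `(ε, T)`-optimal policy with probability at least `1 - δ`. (The events
`τ ≤ n` increase to `τ < ∞`, hence the supremum over `n`.) Nothing is known to the learner about
the hitting time of the optimal policy. -/
def IsCorrect (L : Learner S A) (ε δ T : ℝ) : Prop :=
  ∀ M : SSP S A, (∃ π, M.IsProper π) →
    ENNReal.ofReal (1 - δ) ≤ ⨆ n, L.outputLaw M n {π | M.IsOptimalT ε T π}

/-- `L` has sample complexity at most `n` on `M` at confidence level `δ`: with probability at least
`1 - δ` it uses at most `n` samples. -/
def SampleComplexityLE (L : Learner S A) (M : SSP S A) (δ : ℝ) (n : ℕ) : Prop :=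
  ENNReal.ofReal (1 - δ) ≤ L.outputLaw M n Set.univ

end Learner

/-! The hard instance `LockParams.ssp` is a combination lock attached to many independent best-arm
problems. From the start of the lock one either pays mean cost `BT` to leave, or enters a secret
code free of charge; a wrong digit leads to a penalty state of mean cost `B`. A digit takes effect
only with a tiny probability `p`. With the code, the lock costs nothing, so `B⋆ = B`. A policy of
hitting time at most `T` has almost no chance to see a digit take effect, so its value at the start
is of order `BT`. A decision state waits about `T / 2` steps and then goes to the goal or to the
start, almost evenly; one action may be biased towards the goal by `4 * ε / BT`.

The returned policy may take arbitrarily long, hence might open the lock, but the learner cannot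
know the code. If `n * p ≤ δ`, then `n` samples hardly distinguish the instance from the one with `p
= 0`, whose law does not depend on the code (`prob_le_prob_add`, `expect_trans_le_add`). Every fixed
policy is bad at guessing at least half of the codes (`card_le_two_mul_card_safe`), and against such
a code its value at the start is at least `BT` (`le_value_of_safe`). It must therefore put more than
half of its mass on the biased action (`not_isOptimalT`). Averaging over the codes transfers this to
`p = 0` (`prob_missing_le`).

What remains is a best-arm lower bound. Without bias, at most one action per state gets mass above
`1 / 2`, so nearly all actions are missed; with a bias at `q`, missing `q` has probability at most
`4 * δ`. The change of measure `mul_prob_le_queries` turns this into order `T * BT ^ 2 / ε ^ 2 * log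
(1 / δ)` expected queries of each pair on average: a sample of a decision state is informative only
with probability `2 / T`, and then carries information of order `(ε / BT) ^ 2`. Summing over all
decision pairs gives the theorem. Finally `p` is chosen small enough for all sample sizes below the
claimed bound. -/

/-! ### Means under finite probability vectors, and mixtures. -/

/-- The mean of `f` under the finite probability vector `P`. -/
noncomputable def expect {X : Type*} [Fintype X] (P : stdSimplex ℝ≥0 X) (f : X → ℝ) : ℝ :=
  ∑ y, (P y : ℝ) * f y

section Expect

variable {X : Type*} [Fintype X]

theorem sum_coe_stdSimplex (P : stdSimplex ℝ≥0 X) : ∑ y, (P y : ℝ) = 1 := by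
  exact_mod_cast congrArg (fun r : ℝ≥0 => (r : ℝ)) (stdSimplex.sum_eq_one P)

theorem expect_const (P : stdSimplex ℝ≥0 X) (c : ℝ) : expect P (fun _ => c) = c := by
  simp [expect, ← Finset.sum_mul, sum_coe_stdSimplex]

theorem expect_mono (P : stdSimplex ℝ≥0 X) {f g : X → ℝ} (h : ∀ y, f y ≤ g y) :
    expect P f ≤ expect P g :=
  Finset.sum_le_sum fun y _ => mul_le_mul_of_nonneg_left (h y) (P y).coe_nonneg

theorem expect_nonneg (P : stdSimplex ℝ≥0 X) {f : X → ℝ} (h : ∀ y, 0 ≤ f y) :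
    0 ≤ expect P f :=
  Finset.sum_nonneg fun y _ => mul_nonneg (P y).coe_nonneg (h y)

theorem expect_le_of_forall_le (P : stdSimplex ℝ≥0 X) {f : X → ℝ} {c : ℝ} (h : ∀ y, f y ≤ c) :
    expect P f ≤ c :=
  (expect_mono P h).trans_eq (expect_const P c)

theorem expect_add (P : stdSimplex ℝ≥0 X) (f g : X → ℝ) :
    expect P (fun y => f y + g y) = expect P f + expect P g := by
  simp [expect, mul_add, Finset.sum_add_distrib]

theorem expect_const_mul (P : stdSimplex ℝ≥0 X) (c : ℝ) (f : X → ℝ) :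
    expect P (fun y => c * f y) = c * expect P f := by
  simp only [expect, Finset.mul_sum]
  exact Finset.sum_congr rfl fun _ _ => by ring

theorem expect_neg (P : stdSimplex ℝ≥0 X) (f : X → ℝ) :
    expect P (fun y => - f y) = - expect P f := by
  simp [expect]

theorem expect_sub (P : stdSimplex ℝ≥0 X) (f g : X → ℝ) :
    expect P (fun y => f y - g y) = expect P f - expect P g := by
  simp [expect, mul_sub, Finset.sum_sub_distrib]

theorem expect_sum {ι : Type*} (s : Finset ι) (P : stdSimplex ℝ≥0 X) (f : ι → X → ℝ) :
    expect P (fun y => ∑ i ∈ s, f i y) = ∑ i ∈ s, expect P (f i) := by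
  simp only [expect, Finset.mul_sum]
  exact Finset.sum_comm

open Classical in
/-- The mixture `(1 - w) P + w Q` (and `P` for weights outside `[0, 1]`). -/
noncomputable def mixture (w : ℝ) (P Q : stdSimplex ℝ≥0 X) : stdSimplex ℝ≥0 X :=
  if h : 0 ≤ w ∧ w ≤ 1 then
    ⟨(1 - w).toNNReal • (P : X → ℝ≥0) + w.toNNReal • (Q : X → ℝ≥0),
      convex_stdSimplex ℝ≥0 X P.2 Q.2 zero_le zero_le (by
        rw [← Real.toNNReal_add (by linarith [h.2]) h.1]; simp)⟩
  else P

theorem expect_mixture {w : ℝ} (h0 : 0 ≤ w) (h1 : w ≤ 1) (P Q : stdSimplex ℝ≥0 X) (f : X → ℝ) :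
    expect (mixture w P Q) f = (1 - w) * expect P f + w * expect Q f := by
  have key : ∀ y, ((mixture w P Q y : ℝ≥0) : ℝ) = (1 - w) * (P y : ℝ) + w * (Q y : ℝ) := by
    intro y
    have e : mixture w P Q y = (1 - w).toNNReal * P y + w.toNNReal * Q y := by
      rw [mixture, dif_pos ⟨h0, h1⟩]; rfl
    rw [e]
    push_cast
    rw [Real.coe_toNNReal _ (by linarith), Real.coe_toNNReal _ h0]
  simp only [expect, key, Finset.mul_sum, ← Finset.sum_add_distrib]
  exact Finset.sum_congr rfl fun _ _ => by ring

variable [DecidableEq X]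

/-- The point mass at `x`. -/
def pointMass (x : X) : stdSimplex ℝ≥0 X :=
  ⟨Pi.single x 1, single_mem_stdSimplex _ x⟩

theorem pointMass_apply (x y : X) : pointMass x y = if y = x then 1 else 0 := by
  change (Pi.single x 1 : X → ℝ≥0) y = _
  simp [Pi.single_apply]

theorem expect_pointMass (x : X) (f : X → ℝ) : expect (pointMass x) f = f x := by
  simp [expect, pointMass_apply, apply_ite NNReal.toReal]

end Expect

/-! ### Bellman inequalities as bounds on values and hitting times. -/

namespace SSP

variable {S A : ℕ}

/-- The mean one-step cost of `π`. -/
noncomputable def meanCost (M : SSP S A) (π : Policy S A) (x : Fin S) : ℝ :=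
  expect (π x) fun a => (M.cost x a : ℝ)

/-- The mean of `f` after one step of `π`. -/
noncomputable def meanNext (M : SSP S A) (π : Policy S A) (f : Option (Fin S) → ℝ) (x : Fin S) : ℝ :=
  expect (π x) fun a => expect (M.trans x a) f

/-- The mean of `c` over the non-goal states at time `t`. -/
noncomputable def meanAt (M : SSP S A) (π : Policy S A) (s : Fin S) (c : Fin S → ℝ) (t : ℕ) : ℝ :=
  ∑ x : Fin S, (M.stateLaw π s t (some x) : ℝ) * c x

theorem meanAt_nonneg (M : SSP S A) (π : Policy S A) (s : Fin S) {c : Fin S → ℝ}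
    (hc : ∀ x, 0 ≤ c x) (t : ℕ) : 0 ≤ M.meanAt π s c t :=
  Finset.sum_nonneg fun x _ => mul_nonneg (NNReal.coe_nonneg _) (hc x)

theorem meanCost_nonneg (M : SSP S A) (π : Policy S A) (x : Fin S) : 0 ≤ M.meanCost π x :=
  expect_nonneg _ fun _ => NNReal.coe_nonneg _

theorem value_eq_tsum (M : SSP S A) (π : Policy S A) (s : Fin S) :
    M.value π s = ∑' t, ENNReal.ofReal (M.meanAt π s (M.meanCost π) t) := by
  refine tsum_congr fun t => ?_
  rw [← ENNReal.ofNNReal_finsetSum, ← ENNReal.ofReal_coe_nnreal]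
  simp [meanAt, meanCost, expect]

theorem hitting_eq_tsum (M : SSP S A) (π : Policy S A) (s : Fin S) :
    M.hitting π s = ∑' t, ENNReal.ofReal (M.meanAt π s (fun _ => 1) t) := by
  refine tsum_congr fun t => ?_
  rw [← ENNReal.ofNNReal_finsetSum, ← ENNReal.ofReal_coe_nnreal]
  simp [meanAt]

theorem sum_stateLaw_succ (M : SSP S A) (π : Policy S A) (s : Fin S) (t : ℕ)
    (f : Option (Fin S) → ℝ) :
    ∑ y, (M.stateLaw π s (t + 1) y : ℝ) * f y =
      M.stateLaw π s t none * f none + M.meanAt π s (M.meanNext π f) t := by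
  have step_some : ∀ x, ∑ y, (M.step π (some x) y : ℝ) * f y = M.meanNext π f x := by
    intro x
    simp only [step, meanNext, expect, Finset.mul_sum]
    push_cast
    simp only [Finset.sum_mul]
    rw [Finset.sum_comm]
    exact Finset.sum_congr rfl fun _ _ => Finset.sum_congr rfl fun _ _ => by ring
  have step_none : ∑ y, (M.step π none y : ℝ) * f y = f none := by
    simp [step]
  simp only [stateLaw]
  push_cast
  simp only [Finset.sum_mul]
  rw [Finset.sum_comm]
  simp only [mul_assoc, ← Finset.mul_sum]
  rw [Fintype.sum_option, step_none]
  simp only [step_some, meanAt]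

/-- Dynkin's formula as an inequality: the one-step drift bounds telescope. No drift condition is
needed at the goal, which is absorbing. -/
theorem sum_stateLaw_le (M : SSP S A) (π : Policy S A) (s : Fin S) (f : Option (Fin S) → ℝ)
    (e : Fin S → ℝ) (h : ∀ x, M.meanNext π f x ≤ f (some x) + e x) (n : ℕ) :
    ∑ y, (M.stateLaw π s n y : ℝ) * f y ≤
      f (some s) + ∑ t ∈ Finset.range n, M.meanAt π s e t := by
  induction n with
  | zero => simp [stateLaw, apply_ite NNReal.toReal]
  | succ n ih =>
    rw [sum_stateLaw_succ, Finset.sum_range_succ, ← add_assoc]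
    rw [Fintype.sum_option] at ih
    have : M.meanAt π s (M.meanNext π f) n ≤
        ∑ x, (M.stateLaw π s n (some x) : ℝ) * f (some x) + M.meanAt π s e n := by
      simp only [meanAt, ← Finset.sum_add_distrib, ← mul_add]
      exact Finset.sum_le_sum fun x _ => mul_le_mul_of_nonneg_left (h x) (NNReal.coe_nonneg _)
    linarith

theorem meanAt_add (M : SSP S A) (π : Policy S A) (s : Fin S) (c d : Fin S → ℝ) (t : ℕ) :
    M.meanAt π s (fun x => c x + d x) t = M.meanAt π s c t + M.meanAt π s d t := by
  simp [meanAt, mul_add, Finset.sum_add_distrib]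

theorem meanAt_const_mul (M : SSP S A) (π : Policy S A) (s : Fin S) (c : ℝ) (d : Fin S → ℝ)
    (t : ℕ) : M.meanAt π s (fun x => c * d x) t = c * M.meanAt π s d t := by
  simp only [meanAt, Finset.mul_sum]
  exact Finset.sum_congr rfl fun _ _ => by ring

/-- The potential left at time `n` is nonnegative and can be dropped, so properness of `π` is not
needed. -/
theorem value_le_of_bellman_le (M : SSP S A) (π : Policy S A) (W : Option (Fin S) → ℝ)
    (hW : ∀ y, 0 ≤ W y) (h : ∀ x, M.meanCost π x + M.meanNext π W x ≤ W (some x)) (s : Fin S) :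
    M.value π s ≤ ENNReal.ofReal (W (some s)) := by
  rw [value_eq_tsum]
  refine ENNReal.tsum_le_of_sum_range_le fun n => ?_
  rw [← ENNReal.ofReal_sum_of_nonneg fun t _ => meanAt_nonneg _ _ _ (M.meanCost_nonneg π) t]
  refine ENNReal.ofReal_le_ofReal ?_
  have := M.sum_stateLaw_le π s W (fun x => (-1) * M.meanCost π x) (fun x => by linarith [h x]) n
  simp only [meanAt_const_mul, ← Finset.mul_sum] at this
  have h0 : 0 ≤ ∑ y, (M.stateLaw π s n y : ℝ) * W y :=
    Finset.sum_nonneg fun y _ => mul_nonneg (NNReal.coe_nonneg _) (hW y)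
  linarith

/-- The potential has to fall by one per step only up to `C` times the cost. With `C = 0` this
bounds hitting times outright; with `C > 0` it makes them finite wherever the value is. -/
theorem hitting_le_of_bellman_le (M : SSP S A) (π : Policy S A) (W : Option (Fin S) → ℝ)
    (hW : ∀ y, 0 ≤ W y) {C : ℝ} (hC : 0 ≤ C)
    (h : ∀ x, 1 + M.meanNext π W x ≤ W (some x) + C * M.meanCost π x) (s : Fin S) :
    M.hitting π s ≤ ENNReal.ofReal (W (some s)) + ENNReal.ofReal C * M.value π s := by
  rw [hitting_eq_tsum]
  refine ENNReal.tsum_le_of_sum_range_le fun n => ?_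
  have h1 : ∑ t ∈ Finset.range n, ENNReal.ofReal (M.meanAt π s (M.meanCost π) t) ≤ M.value π s := by
    rw [value_eq_tsum]
    exact ENNReal.sum_le_tsum _
  refine le_trans ?_ (add_le_add_right (mul_le_mul_right h1 _) _)
  have hc := fun t => M.meanAt_nonneg π s (M.meanCost_nonneg π) t
  rw [← ENNReal.ofReal_sum_of_nonneg fun t _ => meanAt_nonneg _ _ _ (fun _ => zero_le_one) t,
    ← ENNReal.ofReal_sum_of_nonneg fun t _ => hc t, ← ENNReal.ofReal_mul hC,
    ← ENNReal.ofReal_add (hW _) (mul_nonneg hC (Finset.sum_nonneg fun t _ => hc t))]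
  refine ENNReal.ofReal_le_ofReal ?_
  have := M.sum_stateLaw_le π s W (fun x => C * M.meanCost π x + (-1) * 1)
    (fun x => by linarith [h x]) n
  simp only [meanAt_add, meanAt_const_mul, ← Finset.mul_sum, Finset.sum_add_distrib] at this
  have h0 : 0 ≤ ∑ y, (M.stateLaw π s n y : ℝ) * W y :=
    Finset.sum_nonneg fun y _ => mul_nonneg (NNReal.coe_nonneg _) (hW y)
  have e : ∑ t ∈ Finset.range n, M.meanAt π s (fun _ => (-1) * 1) t =
    - ∑ t ∈ Finset.range n, M.meanAt π s (fun _ => 1) t := by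
    simp [meanAt]
  linarith

/-- The potential left at time `n` is at most `K` times the probability of not having reached the
goal, which tends to `0` because its sum is the hitting time. Finiteness is essential: a policy may
avoid all cost by never terminating. The slack `η` is charged once per step. -/
theorem le_value_of_le_bellman (M : SSP S A) (π : Policy S A) (Φ : Option (Fin S) → ℝ)
    (hn : Φ none = 0) {K η : ℝ} (hK : ∀ x, Φ x ≤ K) (hη : 0 ≤ η)
    (h : ∀ x, Φ (some x) ≤ M.meanCost π x + η + M.meanNext π Φ x) (s : Fin S)
    (hs : M.hitting π s < ∞) :
    ENNReal.ofReal (Φ (some s)) ≤ M.value π s + ENNReal.ofReal η * M.hitting π s := by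
  have hK0 : 0 ≤ K := hn ▸ hK none
  have ho := fun t => M.meanAt_nonneg π s (c := fun _ => 1) (fun _ => zero_le_one) t
  have hc := fun t => M.meanAt_nonneg π s (M.meanCost_nonneg π) t
  have bound : ∀ n, ENNReal.ofReal (Φ (some s)) ≤
      ENNReal.ofReal K * ENNReal.ofReal (M.meanAt π s (fun _ => 1) n) +
        (M.value π s + ENNReal.ofReal η * M.hitting π s) := by
    intro n
    have h1 : ∑ t ∈ Finset.range n, ENNReal.ofReal (M.meanAt π s (M.meanCost π) t) ≤
        M.value π s := by
      rw [value_eq_tsum]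
      exact ENNReal.sum_le_tsum _
    have h2 : ∑ t ∈ Finset.range n, ENNReal.ofReal (M.meanAt π s (fun _ => 1) t) ≤
        M.hitting π s := by
      rw [hitting_eq_tsum]
      exact ENNReal.sum_le_tsum _
    refine le_trans ?_ (add_le_add_right (add_le_add h1 (mul_le_mul_right h2 _)) _)
    rw [← ENNReal.ofReal_sum_of_nonneg fun t _ => ho t,
      ← ENNReal.ofReal_sum_of_nonneg fun t _ => hc t, ← ENNReal.ofReal_mul hη,
      ← ENNReal.ofReal_mul hK0, ← ENNReal.ofReal_add (Finset.sum_nonneg fun t _ => hc t)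
        (mul_nonneg hη (Finset.sum_nonneg fun t _ => ho t)),
      ← ENNReal.ofReal_add (mul_nonneg hK0 (ho n)) (add_nonneg (Finset.sum_nonneg fun t _ => hc t)
        (mul_nonneg hη (Finset.sum_nonneg fun t _ => ho t)))]
    refine ENNReal.ofReal_le_ofReal ?_
    have hneg : ∀ x, M.meanNext π (fun y => - Φ y) x = - M.meanNext π Φ x := by
      intro x
      simp only [meanNext, expect_neg]
    have := M.sum_stateLaw_le π s (fun y => - Φ y) (fun x => M.meanCost π x + η * 1)
      (fun x => by rw [hneg]; linarith [h x]) n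
    simp only [meanAt_add, meanAt_const_mul, ← Finset.mul_sum, Finset.sum_add_distrib] at this
    rw [Fintype.sum_option, hn] at this
    have h3 : ∑ x, (M.stateLaw π s n (some x) : ℝ) * -K ≤
        ∑ x, (M.stateLaw π s n (some x) : ℝ) * -Φ (some x) :=
      Finset.sum_le_sum fun x _ =>
        mul_le_mul_of_nonneg_left (neg_le_neg (hK _)) (NNReal.coe_nonneg _)
    have h4 : ∑ x, (M.stateLaw π s n (some x) : ℝ) * -K =
        - (K * M.meanAt π s (fun _ => 1) n) := by
      simp [meanAt, mul_comm, Finset.mul_sum]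
    linarith
  have lim : Filter.Tendsto (fun n => ENNReal.ofReal K *
      ENNReal.ofReal (M.meanAt π s (fun _ => 1) n) +
        (M.value π s + ENNReal.ofReal η * M.hitting π s)) Filter.atTop
      (nhds (ENNReal.ofReal K * 0 + (M.value π s + ENNReal.ofReal η * M.hitting π s))) := by
    rw [hitting_eq_tsum] at hs
    exact (ENNReal.Tendsto.const_mul (ENNReal.tendsto_atTop_zero_of_tsum_ne_top hs.ne)
      (Or.inr ENNReal.ofReal_ne_top)).add_const _
  have := ge_of_tendsto' lim bound
  simpa using this

end SSP

/-! ### Concavity of the logarithm. -/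

theorem expect_log_le {X : Type*} [Fintype X] (P : stdSimplex ℝ≥0 X) {g : X → ℝ}
    (hg : ∀ y, 0 < g y) : expect P (fun y => Real.log (g y)) ≤ Real.log (expect P g) := by
  have := strictConcaveOn_log_Ioi.concaveOn.le_map_sum (t := Finset.univ)
    (w := fun y => (P y : ℝ)) (p := g) (fun y _ => NNReal.coe_nonneg _) (sum_coe_stdSimplex P)
    (fun y _ => hg y)
  simpa [expect] using this

/-- The chord of the logarithm between `1` and `exp l`. It handles a randomized output in the change
of measure. -/
theorem mul_le_log_one_add {l o : ℝ} (h0 : 0 ≤ o) (h1 : o ≤ 1) :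
    l * o ≤ Real.log (1 + (Real.exp l - 1) * o) := by
  have := strictConcaveOn_log_Ioi.concaveOn.2 (Set.mem_Ioi.2 (Real.exp_pos l))
    (Set.mem_Ioi.2 zero_lt_one) h0 (sub_nonneg.2 h1) (by ring)
  simp only [Real.log_exp, Real.log_one, smul_eq_mul] at this
  rw [show 1 + (Real.exp l - 1) * o = o * Real.exp l + (1 - o) * 1 by ring]
  linarith

/-! ### Stopping and output probabilities of a learner. -/

namespace Learner

open MeasureTheory

variable {S A : ℕ}

theorem outputLawFrom_succ_apply (L : Learner S A) (M : SSP S A) (n : ℕ) (h : History S A)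
    (E : Set (Policy S A)) :
    L.outputLawFrom M (n + 1) h E =
      L.choose M.cost h none * (L.output M.cost h : Measure (Policy S A)) E +
      ∑ q : Fin S × Fin A, (L.choose M.cost h (some q) : ℝ≥0∞) *
        ∑ y : Option (Fin S), (M.trans q.1 q.2 y : ℝ≥0∞) *
          L.outputLawFrom M n (h ++ [(q, y)]) E := by
  simp only [outputLawFrom, Measure.add_apply, Measure.smul_apply, Measure.finsetSum_apply,
    ENNReal.smul_def, smul_eq_mul]

theorem outputLawFrom_zero_apply (L : Learner S A) (M : SSP S A) (h : History S A)
    (E : Set (Policy S A)) :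
    L.outputLawFrom M 0 h E =
      L.choose M.cost h none * (L.output M.cost h : Measure (Policy S A)) E := by
  simp only [outputLawFrom, Measure.smul_apply, ENNReal.smul_def, smul_eq_mul]

theorem outputLawFrom_lt_top (L : Learner S A) (M : SSP S A) (n : ℕ) (h : History S A)
    (E : Set (Policy S A)) : L.outputLawFrom M n h E < ∞ := by
  induction n generalizing h with
  | zero =>
    rw [outputLawFrom_zero_apply]
    exact ENNReal.mul_lt_top ENNReal.coe_lt_top (measure_lt_top _ _)
  | succ n ih =>
    rw [outputLawFrom_succ_apply]
    refine ENNReal.add_lt_top.2 ⟨ENNReal.mul_lt_top ENNReal.coe_lt_top (measure_lt_top _ _), ?_⟩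
    exact ENNReal.sum_lt_top.2 fun q _ => ENNReal.mul_lt_top ENNReal.coe_lt_top
      (ENNReal.sum_lt_top.2 fun y _ => ENNReal.mul_lt_top ENNReal.coe_lt_top (ih _))

/-- The probability that `L`, run on `M` from the history `h` on, stops after at most `n` further
samples and returns a policy in `E`. -/
noncomputable def prob (L : Learner S A) (M : SSP S A) (E : Set (Policy S A)) (n : ℕ)
    (h : History S A) : ℝ :=
  (L.outputLawFrom M n h E).toReal

/-- The probability that the policy returned after the history `h` belongs to `E`. -/
noncomputable def outputProb (L : Learner S A) (M : SSP S A) (E : Set (Policy S A))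
    (h : History S A) : ℝ :=
  ((L.output M.cost h : Measure (Policy S A)) E).toReal

theorem outputProb_nonneg (L : Learner S A) (M : SSP S A) (E : Set (Policy S A))
    (h : History S A) : 0 ≤ L.outputProb M E h :=
  ENNReal.toReal_nonneg

theorem outputProb_le_one (L : Learner S A) (M : SSP S A) (E : Set (Policy S A))
    (h : History S A) : L.outputProb M E h ≤ 1 :=
  ENNReal.toReal_le_of_le_ofReal zero_le_one (by simpa using prob_le_one)

theorem prob_zero (L : Learner S A) (M : SSP S A) (E : Set (Policy S A)) (h : History S A) :
    L.prob M E 0 h = expect (L.choose M.cost h) fun d =>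
      d.elim (L.outputProb M E h) fun _ => 0 := by
  simp [prob, outputLawFrom_zero_apply, expect, Fintype.sum_option, outputProb]

theorem prob_succ (L : Learner S A) (M : SSP S A) (E : Set (Policy S A)) (n : ℕ)
    (h : History S A) :
    L.prob M E (n + 1) h = expect (L.choose M.cost h) fun d =>
      d.elim (L.outputProb M E h) fun q =>
        expect (M.trans q.1 q.2) fun y => L.prob M E n (h ++ [(q, y)]) := by
  have fin : ∀ q : Fin S × Fin A, ∀ y, (M.trans q.1 q.2 y : ℝ≥0∞) *
      L.outputLawFrom M n (h ++ [(q, y)]) E ≠ ∞ := fun q y =>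
    ENNReal.mul_ne_top ENNReal.coe_ne_top (L.outputLawFrom_lt_top _ _ _ _).ne
  have fin' : ∀ q : Fin S × Fin A, (L.choose M.cost h (some q) : ℝ≥0∞) *
        ∑ y : Option (Fin S), (M.trans q.1 q.2 y : ℝ≥0∞) *
          L.outputLawFrom M n (h ++ [(q, y)]) E ≠ ∞ := fun q =>
    ENNReal.mul_ne_top ENNReal.coe_ne_top (ENNReal.sum_ne_top.2 fun y _ => fin q y)
  simp only [expect]
  rw [prob, outputLawFrom_succ_apply, Fintype.sum_option, ENNReal.toReal_add
    (ENNReal.mul_ne_top ENNReal.coe_ne_top (measure_ne_top _ _))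
    (ENNReal.sum_ne_top.2 fun q _ => fin' q), ENNReal.toReal_sum fun q _ => fin' q]
  simp only [ENNReal.toReal_mul, ENNReal.coe_toReal, Option.elim, outputProb]
  congr 1
  refine Finset.sum_congr rfl fun q _ => ?_
  rw [ENNReal.toReal_sum fun y _ => fin q y]
  simp [prob]

theorem prob_nonneg (L : Learner S A) (M : SSP S A) (E : Set (Policy S A)) (n : ℕ)
    (h : History S A) : 0 ≤ L.prob M E n h :=
  ENNReal.toReal_nonneg

theorem prob_le_one (L : Learner S A) (M : SSP S A) (E : Set (Policy S A)) (n : ℕ)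
    (h : History S A) : L.prob M E n h ≤ 1 := by
  induction n generalizing h with
  | zero =>
    rw [prob_zero]
    refine expect_le_of_forall_le _ ?_
    rintro (_ | q)
    exacts [L.outputProb_le_one _ _ _, zero_le_one]
  | succ n ih =>
    rw [prob_succ]
    refine expect_le_of_forall_le _ ?_
    rintro (_ | q)
    exacts [L.outputProb_le_one _ _ _, expect_le_of_forall_le _ fun y => ih _]

theorem prob_le_succ (L : Learner S A) (M : SSP S A) (E : Set (Policy S A)) (n : ℕ)
    (h : History S A) : L.prob M E n h ≤ L.prob M E (n + 1) h := by
  induction n generalizing h with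
  | zero =>
    rw [prob_zero, prob_succ]
    refine expect_mono _ ?_
    rintro (_ | q)
    exacts [le_rfl, expect_nonneg _ fun y => L.prob_nonneg _ _ _ _]
  | succ n ih =>
    rw [prob_succ, prob_succ]
    refine expect_mono _ ?_
    rintro (_ | q)
    exacts [le_rfl, expect_mono _ fun y => ih _]

theorem prob_mono (L : Learner S A) (M : SSP S A) (E : Set (Policy S A)) (h : History S A) :
    Monotone fun n => L.prob M E n h :=
  monotone_nat_of_le_succ fun n => L.prob_le_succ M E n h

/-- A coupling argument: each sample adds at most `p` to the discrepancy, whatever the learner's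
adaptive choices are. -/
theorem prob_le_prob_add (L : Learner S A) {M M' : SSP S A} (hcost : M.cost = M'.cost) {p : ℝ}
    (hp : 0 ≤ p)
    (htrans : ∀ (q : Fin S × Fin A) (f : Option (Fin S) → ℝ), (∀ y, 0 ≤ f y) → (∀ y, f y ≤ 1) →
      expect (M.trans q.1 q.2) f ≤ expect (M'.trans q.1 q.2) f + p)
    (E : Set (Policy S A)) (n : ℕ) (h : History S A) :
    L.prob M E n h ≤ L.prob M' E n h + n * p := by
  have hout : L.outputProb M E h = L.outputProb M' E h := by simp [outputProb, hcost]
  induction n generalizing h with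
  | zero => rw [prob_zero, prob_zero, hcost, hout]; simp
  | succ n ih =>
    rw [prob_succ, prob_succ, hcost, hout, ← expect_const (L.choose M'.cost h) (((n + 1 : ℕ) : ℝ) * p),
      ← expect_add]
    refine expect_mono _ ?_
    push_cast
    rintro (_ | q)
    · simp only [Option.elim]
      nlinarith [(Nat.cast_nonneg n : (0 : ℝ) ≤ n)]
    · simp only [Option.elim]
      have h1 := htrans q (fun y => L.prob M E n (h ++ [(q, y)]))
        (fun y => L.prob_nonneg _ _ _ _) (fun y => L.prob_le_one _ _ _ _)
      have h2 := expect_mono (M'.trans q.1 q.2) fun y =>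
        ih (h ++ [(q, y)]) (by simp [outputProb, hcost])
      rw [expect_add, expect_const] at h2
      linarith

/-! ### Query counts and change of measure. -/

/-- The expected number of times that `L`, run on `M` from the history `h` on, queries `q₀`
among the next `n` samples. -/
noncomputable def queries (L : Learner S A) (M : SSP S A) (q₀ : Fin S × Fin A) :
    ℕ → History S A → ℝ
  | 0, _ => 0
  | n + 1, h => expect (L.choose M.cost h) fun d => d.elim 0 fun q =>
      (if q = q₀ then 1 else 0) +
        expect (M.trans q.1 q.2) fun y => L.queries M q₀ n (h ++ [(q, y)])

theorem queries_nonneg (L : Learner S A) (M : SSP S A) (q₀ : Fin S × Fin A) (n : ℕ)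
    (h : History S A) : 0 ≤ L.queries M q₀ n h := by
  induction n generalizing h with
  | zero => exact le_rfl
  | succ n ih =>
    refine expect_nonneg _ ?_
    rintro (_ | q)
    · exact le_rfl
    · exact add_nonneg (by split_ifs <;> norm_num) (expect_nonneg _ fun y => ih _)

theorem sum_queries_le (L : Learner S A) (M : SSP S A) (n : ℕ) (h : History S A) :
    ∑ q₀, L.queries M q₀ n h ≤ n := by
  induction n generalizing h with
  | zero => simp [queries]
  | succ n ih =>
    simp only [queries]
    rw [← expect_sum]
    refine expect_le_of_forall_le _ ?_
    push_cast
    rintro (_ | q)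
    · simp only [Option.elim, Finset.sum_const_zero]
      positivity
    · simp only [Option.elim, Finset.sum_add_distrib, Finset.sum_ite_eq, Finset.mem_univ, if_true]
      rw [← expect_sum]
      have := expect_le_of_forall_le (M.trans q.1 q.2) fun y => ih (h ++ [(q, y)])
      linarith

/-- The Donsker–Varadhan inequality for the function `l` times the indicator of stopping in time
with output in `E`, together with the chain rule for relative entropy. Hypothesis `hD` is the dual
form of a bound `D` on the relative entropy of the two laws at `q₀`, so no densities occur and the
induction on `n` is direct. All randomness common to both models is handled by Jensen's inequality.
-/
theorem mul_prob_le_queries (L : Learner S A) {M₀ M₁ : SSP S A} (hcost : M₀.cost = M₁.cost)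
    (q₀ : Fin S × Fin A) {D l : ℝ} (hl : 0 ≤ l)
    (htrans : ∀ q ≠ q₀, M₀.trans q.1 q.2 = M₁.trans q.1 q.2)
    (hD : ∀ g : Option (Fin S) → ℝ, (∀ y, 0 < g y) →
      expect (M₀.trans q₀.1 q₀.2) (fun y => Real.log (g y)) ≤
        D + Real.log (expect (M₁.trans q₀.1 q₀.2) g))
    (E : Set (Policy S A)) (n : ℕ) (h : History S A) :
    l * L.prob M₀ E n h ≤ D * L.queries M₀ q₀ n h +
      Real.log (1 + (Real.exp l - 1) * L.prob M₁ E n h) := by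
  have hexp : 0 ≤ Real.exp l - 1 := by linarith [Real.one_le_exp hl]
  have row : ∀ (q : Fin S × Fin A) (g : Option (Fin S) → ℝ), (∀ y, 0 < g y) →
      expect (M₀.trans q.1 q.2) (fun y => Real.log (g y)) ≤
        D * (if q = q₀ then 1 else 0) + Real.log (expect (M₁.trans q.1 q.2) g) := by
    intro q g hg
    by_cases hq : q = q₀
    · subst hq
      simpa using hD g hg
    · rw [htrans q hq, if_neg hq]
      simpa using expect_log_le _ hg
  have mix : ∀ (h : History S A) (a₀ k a₁ : Option (Fin S × Fin A) → ℝ), (∀ d, 0 ≤ a₁ d) →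
      (∀ d, l * a₀ d ≤ D * k d + Real.log (1 + (Real.exp l - 1) * a₁ d)) →
      l * expect (L.choose M₀.cost h) a₀ ≤ D * expect (L.choose M₀.cost h) k +
        Real.log (1 + (Real.exp l - 1) * expect (L.choose M₀.cost h) a₁) := by
    intro h a₀ k a₁ ha hd
    have h1 := expect_mono (L.choose M₀.cost h) hd
    have h2 := expect_log_le (L.choose M₀.cost h)
      (g := fun d => 1 + (Real.exp l - 1) * a₁ d) (fun d => by
        have := mul_nonneg hexp (ha d)
        linarith)
    rw [expect_add, expect_const, expect_const_mul] at h2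
    rw [expect_add, expect_const_mul, expect_const_mul] at h1
    linarith
  have hout : ∀ h, L.outputProb M₁ E h = L.outputProb M₀ E h := by simp [outputProb, hcost]
  induction n generalizing h with
  | zero =>
    have := mix h (fun d => d.elim (L.outputProb M₀ E h) fun _ => 0) (fun _ => 0)
      (fun d => d.elim (L.outputProb M₀ E h) fun _ => 0)
      (by rintro (_ | q); exacts [L.outputProb_nonneg _ _ _, le_rfl])
      (by
        rintro (_ | q)
        · simpa using mul_le_log_one_add (L.outputProb_nonneg M₀ E h) (L.outputProb_le_one M₀ E h)
        · simp)
    rw [prob_zero, prob_zero, ← hcost, hout, queries]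
    rwa [expect_const] at this
  | succ n ih =>
    rw [prob_succ, prob_succ, ← hcost, hout, queries]
    refine mix h _ _ _ ?_ ?_
    · rintro (_ | q)
      exacts [L.outputProb_nonneg _ _ _, expect_nonneg _ fun y => L.prob_nonneg _ _ _ _]
    · rintro (_ | q)
      · simpa using mul_le_log_one_add (L.outputProb_nonneg M₀ E h) (L.outputProb_le_one M₀ E h)
      · simp only [Option.elim]
        have h1 := expect_mono (M₀.trans q.1 q.2) fun y => ih (h ++ [(q, y)])
        have h2 := row q (fun y => 1 + (Real.exp l - 1) * L.prob M₁ E n (h ++ [(q, y)]))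
          (fun y => by
            have := mul_nonneg hexp (L.prob_nonneg M₁ E n (h ++ [(q, y)]))
            linarith)
        rw [expect_add, expect_const, expect_const_mul] at h2
        rw [expect_add, expect_const_mul, expect_const_mul] at h1
        linarith

theorem outputLaw_eq_ofReal_prob (L : Learner S A) (M : SSP S A) (n : ℕ)
    (E : Set (Policy S A)) : L.outputLaw M n E = ENNReal.ofReal (L.prob M E n []) :=
  (ENNReal.ofReal_toReal (L.outputLawFrom_lt_top M n [] E).ne).symm

/-- The good event is disjoint from `E`, and both probabilities grow with the number of samples.
Only `E` has to be measurable: the set of optimal policies is replaced by the larger set `Eᶜ`. -/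
theorem IsCorrect.prob_le {L : Learner S A} {ε δ T : ℝ} (hL : L.IsCorrect ε δ T) {M : SSP S A}
    (hM : ∃ π, M.IsProper π) {E : Set (Policy S A)} (hE : MeasurableSet E)
    (hopt : ∀ π ∈ E, ¬ M.IsOptimalT ε T π) (n : ℕ) : L.prob M E n [] ≤ δ := by
  have bound : ∀ m, L.outputLaw M m {π | M.IsOptimalT ε T π} ≤
      ENNReal.ofReal (1 - L.prob M E n []) := by
    intro m
    have hsub : {π | M.IsOptimalT ε T π} ⊆ Eᶜ := fun π hπ hE => hopt π hE hπ
    refine (measure_mono hsub).trans ?_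
    rw [outputLaw_eq_ofReal_prob]
    refine ENNReal.ofReal_le_ofReal ?_
    have h1 := L.prob_mono M Eᶜ [] (le_max_left m n)
    have h2 := L.prob_mono M E [] (le_max_right m n)
    have h3 := L.prob_le_one M Set.univ (max m n) []
    have h4 : L.prob M Set.univ (max m n) [] =
        L.prob M E (max m n) [] + L.prob M Eᶜ (max m n) [] := by
      rw [prob, prob, prob, ← ENNReal.toReal_add (L.outputLawFrom_lt_top _ _ _ _).ne
        (L.outputLawFrom_lt_top _ _ _ _).ne, measure_add_measure_compl hE]
    dsimp only at h1 h2
    linarith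
  have := (hL M hM).trans (iSup_le bound)
  rw [ENNReal.ofReal_le_ofReal_iff (by linarith [L.prob_le_one M E n []])] at this
  linarith

end Learner

/-! ### The combination lock instance and its one-step means. -/

/-- The parameters of a combination lock: the states below `k` form the lock, state `k` is the
penalty state of mean cost `B`, and the states above `k` are decision states. Leaving the lock
without using it has mean cost `BT`. -/
structure LockParams (S : ℕ) where
  k : ℕ
  k_pos : 0 < k
  k_lt : k < S
  B : ℝ
  BT : ℝ
  T : ℝ
  one_le_B : 1 ≤ B
  two_le_BT : 2 ≤ BT
  B_le_BT : B ≤ BT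
  six_mul_BT_le_T : 6 * BT ≤ T

namespace LockParams

variable {S A : ℕ} (P : LockParams S)

/-- The first state of the lock. -/
def start : Fin S := ⟨0, P.k_pos.trans P.k_lt⟩

/-- The penalty state. -/
def penalty : Fin S := ⟨P.k, P.k_lt⟩

/-- The `i`-th state of the lock. -/
def lock (i : Fin P.k) : Fin S := ⟨i, i.2.trans P.k_lt⟩

/-- The successor of `x` in the lock; the last state of the lock leads to the goal. -/
def next (x : Fin S) : Option (Fin S) :=
  if h : (x : ℕ) + 1 < P.k then some ⟨x + 1, h.trans P.k_lt⟩ else none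

/-- The transition law of a decision state `x` with bias `b`. -/
noncomputable def decisionLaw (x : Fin S) (b : ℝ) : stdSimplex ℝ≥0 (Option (Fin S)) :=
  mixture (2 / P.T) (pointMass (some x))
    (mixture (1 / 2 - b) (pointMass none) (pointMass (some P.start)))

/-- The combination lock with the secret `code`. In the lock, action `0` leaves to the goal at mean
cost `BT`; the other actions are free and have an effect with probability `p`: the right one leads
on, the others lead to the penalty state. A decision state leads to the goal or to the lock. -/
noncomputable def ssp (p : ℝ) (code : Fin P.k → Fin A) (bias : Fin S → Fin (A + 1) → ℝ) :
    SSP S (A + 1) where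
  cost x a := if (x : ℕ) < P.k then (if a = 0 then 1 else 0) else if (x : ℕ) = P.k then 1 else 0
  cost_le_one x a := by split_ifs <;> simp
  trans x a :=
    if h : (x : ℕ) < P.k then
      Fin.cases (mixture (1 / P.BT) (pointMass (some x)) (pointMass none))
        (fun j => mixture p (pointMass (some x))
          (pointMass (if j = code ⟨x, h⟩ then P.next x else some P.penalty))) a
    else if (x : ℕ) = P.k then mixture (1 / P.B) (pointMass (some x)) (pointMass (some P.start))
    else P.decisionLaw x (bias x a)

variable {p : ℝ} {code : Fin P.k → Fin A} {bias : Fin S → Fin (A + 1) → ℝ}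

theorem B_pos : 0 < P.B := by linarith [P.one_le_B]

theorem BT_pos : 0 < P.BT := by linarith [P.two_le_BT]

theorem T_pos : 0 < P.T := by linarith [P.two_le_BT, P.six_mul_BT_le_T]

theorem two_div_T_le_one : 2 / P.T ≤ 1 := by
  rw [div_le_one P.T_pos]
  linarith [P.two_le_BT, P.six_mul_BT_le_T]

theorem expect_decisionLaw (x : Fin S) {b : ℝ} (hb : 0 ≤ b) (hb' : b ≤ 1 / 2)
    (f : Option (Fin S) → ℝ) :
    expect (P.decisionLaw x b) f =
      (1 - 2 / P.T) * f (some x) + 2 / P.T * ((1 / 2 + b) * f none + (1 / 2 - b) * f (some P.start)) := by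
  rw [decisionLaw, expect_mixture (div_nonneg zero_le_two P.T_pos.le) P.two_div_T_le_one,
    expect_mixture (by linarith) (by linarith)]
  simp only [expect_pointMass]
  ring

theorem cost_eq_cost (p' : ℝ) (code' : Fin P.k → Fin A) (bias' : Fin S → Fin (A + 1) → ℝ) :
    (P.ssp p code bias).cost = (P.ssp p' code' bias').cost := rfl

theorem cost_lock_zero {x : Fin S} (hx : (x : ℕ) < P.k) : (P.ssp p code bias).cost x 0 = 1 := by
  simp [ssp, hx]

theorem cost_lock_succ {x : Fin S} (hx : (x : ℕ) < P.k) (j : Fin A) :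
    (P.ssp p code bias).cost x j.succ = 0 := by
  simp [ssp, hx]

theorem cost_penalty {x : Fin S} (hx : (x : ℕ) = P.k) (a : Fin (A + 1)) :
    (P.ssp p code bias).cost x a = 1 := by
  simp [ssp, hx]

theorem cost_decision {x : Fin S} (hx : P.k < (x : ℕ)) (a : Fin (A + 1)) :
    (P.ssp p code bias).cost x a = 0 := by
  simp [ssp, hx.not_gt, hx.ne']

theorem trans_decision {x : Fin S} (hx : P.k < (x : ℕ)) (a : Fin (A + 1)) :
    (P.ssp p code bias).trans x a = P.decisionLaw x (bias x a) := by
  simp [ssp, hx.not_gt, hx.ne']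

theorem trans_lock_zero {x : Fin S} (hx : (x : ℕ) < P.k) :
    (P.ssp p code bias).trans x 0 =
      mixture (1 / P.BT) (pointMass (some x)) (pointMass none) := by
  simp [ssp, hx]

theorem trans_lock_succ {x : Fin S} (hx : (x : ℕ) < P.k) (j : Fin A) :
    (P.ssp p code bias).trans x j.succ = mixture p (pointMass (some x))
      (pointMass (if j = code ⟨x, hx⟩ then P.next x else some P.penalty)) := by
  simp [ssp, hx]

theorem trans_penalty {x : Fin S} (hx : (x : ℕ) = P.k) (a : Fin (A + 1)) :
    (P.ssp p code bias).trans x a =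
      mixture (1 / P.B) (pointMass (some x)) (pointMass (some P.start)) := by
  simp [ssp, hx]

theorem expect_trans_lock_zero {x : Fin S} (hx : (x : ℕ) < P.k) (f : Option (Fin S) → ℝ) :
    expect ((P.ssp p code bias).trans x 0) f =
      (1 - 1 / P.BT) * f (some x) + 1 / P.BT * f none := by
  rw [trans_lock_zero P hx, expect_mixture (by have := P.BT_pos; positivity)
    (by rw [div_le_one P.BT_pos]; linarith [P.two_le_BT])]
  simp only [expect_pointMass]

theorem expect_trans_lock_succ (hp : 0 ≤ p) (hp' : p ≤ 1) {x : Fin S} (hx : (x : ℕ) < P.k)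
    (j : Fin A) (f : Option (Fin S) → ℝ) :
    expect ((P.ssp p code bias).trans x j.succ) f =
      (1 - p) * f (some x) + p * (if j = code ⟨x, hx⟩ then f (P.next x) else f (some P.penalty)) := by
  rw [trans_lock_succ P hx, expect_mixture hp hp']
  simp only [expect_pointMass, apply_ite f]

theorem expect_trans_penalty {x : Fin S} (hx : (x : ℕ) = P.k) (a : Fin (A + 1))
    (f : Option (Fin S) → ℝ) :
    expect ((P.ssp p code bias).trans x a) f =
      (1 - 1 / P.B) * f (some x) + 1 / P.B * f (some P.start) := by
  rw [trans_penalty P hx, expect_mixture (by have := P.B_pos; positivity)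
    (by rw [div_le_one P.B_pos]; exact P.one_le_B)]
  simp only [expect_pointMass]

theorem expect_policy_succ (μ : stdSimplex ℝ≥0 (Fin (A + 1))) (v : Fin (A + 1) → ℝ) :
    expect μ v = μ 0 * v 0 + ∑ j : Fin A, (μ j.succ : ℝ) * v j.succ :=
  Fin.sum_univ_succ _

theorem sum_policy_succ (μ : stdSimplex ℝ≥0 (Fin (A + 1))) :
    ∑ j : Fin A, (μ j.succ : ℝ) = 1 - μ 0 := by
  have := sum_coe_stdSimplex μ
  rw [Fin.sum_univ_succ] at this
  linarith

theorem meanCost_lock {x : Fin S} (hx : (x : ℕ) < P.k) (π : Policy S (A + 1)) :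
    (P.ssp p code bias).meanCost π x = π x 0 := by
  rw [SSP.meanCost, expect_policy_succ]
  simp [cost_lock_zero P hx, cost_lock_succ P hx]

theorem meanCost_penalty {x : Fin S} (hx : (x : ℕ) = P.k) (π : Policy S (A + 1)) :
    (P.ssp p code bias).meanCost π x = 1 := by
  simp [SSP.meanCost, cost_penalty P hx, expect_const]

theorem meanCost_decision {x : Fin S} (hx : P.k < (x : ℕ)) (π : Policy S (A + 1)) :
    (P.ssp p code bias).meanCost π x = 0 := by
  simp [SSP.meanCost, cost_decision P hx, expect_const]

theorem meanNext_lock (hp : 0 ≤ p) (hp' : p ≤ 1) {x : Fin S} (hx : (x : ℕ) < P.k)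
    (π : Policy S (A + 1)) (f : Option (Fin S) → ℝ) :
    (P.ssp p code bias).meanNext π f x =
      π x 0 * ((1 - 1 / P.BT) * f (some x) + 1 / P.BT * f none) +
      (1 - π x 0) * ((1 - p) * f (some x) + p * f (some P.penalty)) +
      π x (code ⟨x, hx⟩).succ * (p * (f (P.next x) - f (some P.penalty))) := by
  have e : ∀ j : Fin A, (π x j.succ : ℝ) * ((1 - p) * f (some x) +
      p * (if j = code ⟨x, hx⟩ then f (P.next x) else f (some P.penalty))) =
      (π x j.succ : ℝ) * ((1 - p) * f (some x) + p * f (some P.penalty)) +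
      if j = code ⟨x, hx⟩ then (π x j.succ : ℝ) * (p * (f (P.next x) - f (some P.penalty)))
        else 0 := by
    intro j
    split_ifs <;> ring
  rw [SSP.meanNext, expect_policy_succ, expect_trans_lock_zero P hx]
  simp only [expect_trans_lock_succ P hp hp' hx, e]
  rw [Finset.sum_add_distrib, ← Finset.sum_mul, sum_policy_succ, Finset.sum_ite_eq',
    if_pos (Finset.mem_univ _), add_assoc]

theorem meanNext_penalty {x : Fin S} (hx : (x : ℕ) = P.k) (π : Policy S (A + 1))
    (f : Option (Fin S) → ℝ) :
    (P.ssp p code bias).meanNext π f x =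
      (1 - 1 / P.B) * f (some x) + 1 / P.B * f (some P.start) := by
  simp only [SSP.meanNext, expect_trans_penalty P hx, expect_const]

theorem meanNext_decision (hb : ∀ x a, 0 ≤ bias x a) (hb' : ∀ x a, bias x a ≤ 1 / 2) {x : Fin S}
    (hx : P.k < (x : ℕ)) (π : Policy S (A + 1)) {f : Option (Fin S) → ℝ} (hf : f none = 0) :
    (P.ssp p code bias).meanNext π f x = (1 - 2 / P.T) * f (some x) +
      2 / P.T * ((1 / 2 - expect (π x) (bias x)) * f (some P.start)) := by
  have e : ∀ a, expect ((P.ssp p code bias).trans x a) f =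
      ((1 - 2 / P.T) * f (some x) + 2 / P.T * (1 / 2) * f (some P.start)) -
        2 / P.T * f (some P.start) * bias x a := by
    intro a
    rw [trans_decision P hx, expect_decisionLaw P x (hb x a) (hb' x a), hf]
    ring
  simp only [SSP.meanNext, e]
  rw [expect_sub, expect_const, expect_const_mul]
  ring

theorem apply_next {f : Option (Fin S) → ℝ} {g : ℕ → ℝ}
    (hf : ∀ y : Fin S, (y : ℕ) < P.k → f (some y) = g y) (h0 : f none = g P.k) {x : Fin S}
    (hx : (x : ℕ) < P.k) : f (P.next x) = g (x + 1) := by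
  rw [next]
  split_ifs with h
  · exact hf _ h
  · rw [h0]
    congr 1
    omega

/-- The function on the extended state space with values `g i` at the `i`-th state of the lock, `r`
at the penalty state, `d` at the decision states and `0` at the goal. -/
def potential (g : ℕ → ℝ) (r : ℝ) (d : Fin S → ℝ) (y : Option (Fin S)) : ℝ :=
  y.elim 0 fun x => if (x : ℕ) < P.k then g x else if (x : ℕ) = P.k then r else d x

section Potential

variable (g : ℕ → ℝ) (r : ℝ) (d : Fin S → ℝ)

theorem potential_none : P.potential g r d none = 0 := rfl

theorem potential_lock {x : Fin S} (hx : (x : ℕ) < P.k) : P.potential g r d (some x) = g x := by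
  simp [potential, hx]

theorem potential_start : P.potential g r d (some P.start) = g 0 :=
  P.potential_lock g r d (x := P.start) P.k_pos

theorem potential_of_eq {x : Fin S} (hx : (x : ℕ) = P.k) :
    P.potential g r d (some x) = r := by
  simp [potential, hx]

theorem potential_penalty : P.potential g r d (some P.penalty) = r :=
  P.potential_of_eq g r d rfl

theorem potential_decision {x : Fin S} (hx : P.k < (x : ℕ)) :
    P.potential g r d (some x) = d x := by
  simp [potential, hx.not_gt, hx.ne']

theorem potential_next {g : ℕ → ℝ} (hg : g P.k = 0) {x : Fin S} (hx : (x : ℕ) < P.k) :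
    P.potential g r d (P.next x) = g (x + 1) :=
  P.apply_next (fun _ hy => P.potential_lock g r d hy) hg.symm hx

theorem potential_le {K : ℝ} (h0 : 0 ≤ K) (hg : ∀ i < P.k, g i ≤ K) (hr : r ≤ K)
    (hd : ∀ x, d x ≤ K) (y : Option (Fin S)) : P.potential g r d y ≤ K := by
  rcases y with _ | x
  · exact h0
  · simp only [potential, Option.elim]
    split_ifs with h
    exacts [hg _ h, hr, hd x]

theorem potential_nonneg (hg : ∀ i < P.k, 0 ≤ g i) (hr : 0 ≤ r)
    (hd : ∀ x, 0 ≤ d x) (y : Option (Fin S)) : 0 ≤ P.potential g r d y := by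
  rcases y with _ | x
  · exact le_rfl
  · simp only [potential, Option.elim]
    split_ifs with h
    exacts [hg _ h, hr, hd x]

end Potential

/-! ### Values and hitting times in the lock instance. -/

/-- The policy that leaves the lock by action `0` and takes action `a` in the decision states. -/
def payPolicy (a : Fin (A + 1)) : Policy S (A + 1) :=
  fun x => pointMass (if P.k < (x : ℕ) then a else 0)

theorem payPolicy_lock (a : Fin (A + 1)) {x : Fin S} (hx : (x : ℕ) < P.k) (b : Fin (A + 1)) :
    P.payPolicy a x b = if b = 0 then 1 else 0 := by
  simp [payPolicy, hx.not_gt, pointMass_apply]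

theorem payPolicy_decision (a : Fin (A + 1)) {x : Fin S} (hx : P.k < (x : ℕ))
    (v : Fin (A + 1) → ℝ) : expect (P.payPolicy a x) v = v a := by
  simp [payPolicy, hx, expect_pointMass]

theorem value_payPolicy_le (hp : 0 ≤ p) (hp' : p ≤ 1) (hb : ∀ x a, 0 ≤ bias x a)
    (hb' : ∀ x a, bias x a ≤ 1 / 2) (a : Fin (A + 1)) (x : Fin S) :
    (P.ssp p code bias).value (P.payPolicy a) x ≤ ENNReal.ofReal (P.potential (fun _ => P.BT)
      (P.B + P.BT) (fun x => P.BT * (1 / 2 - bias x a)) (some x)) := by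
  have h1 := P.B_pos
  have h2 := P.BT_pos
  refine SSP.value_le_of_bellman_le _ _ _ (P.potential_nonneg _ _ _ (fun _ _ => h2.le)
    (by linarith) fun x => mul_nonneg h2.le (by linarith [hb' x a])) (fun x => ?_) x
  rcases lt_trichotomy (x : ℕ) P.k with hx | hx | hx
  · rw [meanCost_lock P hx, meanNext_lock P hp hp' hx, payPolicy_lock P a hx,
      payPolicy_lock P a hx, potential_none, potential_lock P _ _ _ hx]
    simp
    field_simp
    linarith
  · rw [meanCost_penalty P hx, meanNext_penalty P hx, potential_start, potential_of_eq P _ _ _ hx]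
    field_simp
    linarith
  · rw [meanCost_decision P hx, meanNext_decision P hb hb' hx _ (P.potential_none _ _ _),
      potential_start, potential_decision P _ _ _ hx, payPolicy_decision P a hx]
    exact le_of_eq (by ring)

theorem hitting_payPolicy_le (hp : 0 ≤ p) (hp' : p ≤ 1) (hb : ∀ x a, 0 ≤ bias x a)
    (hb' : ∀ x a, bias x a ≤ 1 / 2) (a : Fin (A + 1)) (x : Fin S) :
    (P.ssp p code bias).hitting (P.payPolicy a) x ≤ ENNReal.ofReal P.T := by
  have h1 := P.B_pos
  have h2 := P.BT_pos
  have h3 := P.T_pos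
  have h4 := P.six_mul_BT_le_T
  have h5 := P.B_le_BT
  -- Leaving the lock takes `BT` steps on average, the penalty state `B` more, and a decision state
  -- `T / 2` steps before at worst entering the lock. All of this is below `T` since `6 * BT ≤ T`.
  have := SSP.hitting_le_of_bellman_le (P.ssp p code bias) (P.payPolicy a)
    (P.potential (fun _ => P.BT) (P.B + P.BT) (fun _ => P.T / 2 + P.BT))
    (P.potential_nonneg _ _ _ (fun _ _ => h2.le) (by linarith) fun x => by linarith)
    le_rfl (fun x => ?_) x
  · rw [ENNReal.ofReal_zero, zero_mul, add_zero] at this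
    exact this.trans (ENNReal.ofReal_le_ofReal (P.potential_le _ _ _ (by linarith)
      (fun _ _ => by linarith) (by linarith) (fun _ => by linarith) _))
  rw [zero_mul, add_zero]
  rcases lt_trichotomy (x : ℕ) P.k with hx | hx | hx
  · rw [meanNext_lock P hp hp' hx, payPolicy_lock P a hx,
      payPolicy_lock P a hx, potential_none, potential_lock P _ _ _ hx]
    simp
    field_simp
    linarith
  · rw [meanNext_penalty P hx, potential_start, potential_of_eq P _ _ _ hx]
    field_simp
    linarith
  · rw [meanNext_decision P hb hb' hx _ (P.potential_none _ _ _),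
      potential_start, potential_decision P _ _ _ hx, payPolicy_decision P a hx]
    have e : 1 + ((1 - 2 / P.T) * (P.T / 2 + P.BT) + 2 / P.T * ((1 / 2 - bias x a) * P.BT)) =
        P.T / 2 + P.BT - 2 / P.T * ((1 / 2 + bias x a) * P.BT) := by
      field_simp
      ring
    rw [e]
    have : 0 ≤ 2 / P.T * ((1 / 2 + bias x a) * P.BT) := by
      have := hb x a
      positivity
    linarith

/-- The policy that opens the lock. -/
def codePolicy (code : Fin P.k → Fin A) : Policy S (A + 1) :=
  fun x => pointMass (if h : (x : ℕ) < P.k then (code ⟨x, h⟩).succ else 0)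

theorem value_codePolicy_le (hp : 0 ≤ p) (hp' : p ≤ 1) (hb : ∀ x a, 0 ≤ bias x a)
    (hb' : ∀ x a, bias x a ≤ 1 / 2) (x : Fin S) :
    (P.ssp p code bias).value (P.codePolicy code) x ≤ ENNReal.ofReal P.B := by
  have h1 := P.B_pos
  refine (SSP.value_le_of_bellman_le _ _ (P.potential (fun _ => 0) P.B (fun _ => 0))
    (P.potential_nonneg _ _ _ (fun _ _ => le_rfl) h1.le fun _ => le_rfl) (fun x => ?_) x).trans
    (ENNReal.ofReal_le_ofReal (P.potential_le _ _ _ h1.le (fun _ _ => h1.le) le_rfl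
      (fun _ => h1.le) _))
  rcases lt_trichotomy (x : ℕ) P.k with hx | hx | hx
  · rw [meanCost_lock P hx, meanNext_lock P hp hp' hx, potential_none,
      potential_lock P _ _ _ hx, potential_next P _ _ rfl hx, potential_penalty]
    simp [codePolicy, hx, pointMass_apply, (Fin.succ_ne_zero _).symm]
  · rw [meanCost_penalty P hx, meanNext_penalty P hx, potential_start, potential_of_eq P _ _ _ hx]
    field_simp
    linarith
  · rw [meanCost_decision P hx, meanNext_decision P hb hb' hx _ (P.potential_none _ _ _),
      potential_start, potential_decision P _ _ _ hx]
    simp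

/-- A policy can circulate forever only by visiting the penalty state or by using action `0`, and
both cost. This supplies the finite hitting time that `le_value_of_le_bellman` needs. -/
theorem hitting_lt_top_of_value_lt_top (hp : 0 < p) (hp' : p ≤ 1) (hb : ∀ x a, 0 ≤ bias x a)
    (hb' : ∀ x a, bias x a ≤ 1 / 2) (π : Policy S (A + 1)) (x : Fin S)
    (hx : (P.ssp p code bias).value π x < ∞) : (P.ssp p code bias).hitting π x < ∞ := by
  have h1 := P.B_pos
  have h2 := P.BT_pos
  have h3 := P.T_pos
  have hk : 0 ≤ P.k / p := by positivity
  -- A digit takes effect after `1 / p` steps on average, so `(k - i) / p` bounds the time spent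
  -- entering the rest of the code; a mistake only lowers the potential. The return from the penalty
  -- state raises it by `k / p`, which `C` charges to the cost there.
  refine (SSP.hitting_le_of_bellman_le (P.ssp p code bias) π
    (P.potential (fun i => (P.k - i : ℝ) / p) 0 (fun _ => P.T / 2 + P.k / p))
    (P.potential_nonneg _ _ _ (fun i hi => div_nonneg (sub_nonneg.2 (Nat.cast_le.2 hi.le)) hp.le)
      le_rfl fun x => by positivity)
    (C := 1 + P.k / p) (by positivity) (fun x => ?_) x).trans_lt
    (ENNReal.add_lt_top.2 ⟨ENNReal.ofReal_lt_top, ENNReal.mul_lt_top ENNReal.ofReal_lt_top hx⟩)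
  rcases lt_trichotomy (x : ℕ) P.k with hx | hx | hx
  · rw [meanCost_lock P hx, meanNext_lock P hp.le hp' hx, potential_none,
      potential_lock P _ _ _ hx, potential_next P _ _ (by simp) hx, potential_penalty]
    have hw : 1 ≤ (P.k - x : ℝ) := by
      have : ((x : ℕ) : ℝ) + 1 ≤ P.k := by exact_mod_cast hx
      linarith
    set w : ℝ := P.k - x with hwdef
    have e : (P.k - ((x + 1 : ℕ) : ℝ)) / p = (w - 1) / p := by
      push_cast
      rw [hwdef, sub_sub]
    rw [e]
    have q0 : 0 ≤ (π x 0 : ℝ) := NNReal.coe_nonneg _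
    have hsum := sum_policy_succ (π x)
    have qc : (π x (code ⟨x, hx⟩).succ : ℝ) ≤ 1 - π x 0 := by
      rw [← hsum]
      exact Finset.single_le_sum (f := fun j : Fin A => (π x j.succ : ℝ))
        (fun j _ => NNReal.coe_nonneg _) (Finset.mem_univ _)
    have e2 : p * ((w - 1) / p - 0) = w - 1 := by field_simp; ring
    have e3 : (1 - p) * (w / p) + p * 0 = w / p - w := by field_simp; ring
    rw [e2, e3]
    have a1 : (π x (code ⟨x, hx⟩).succ : ℝ) * (w - 1) ≤ (1 - π x 0) * (w - 1) :=
      mul_le_mul_of_nonneg_right qc (by linarith)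
    have a2 : 0 ≤ (π x 0 : ℝ) * (1 / P.BT * (w / p)) := by positivity
    have a3 : 0 ≤ (π x 0 : ℝ) * (P.k / p) := by positivity
    nlinarith
  · rw [meanCost_penalty P hx, meanNext_penalty P hx, potential_start, potential_of_eq P _ _ _ hx]
    have : 1 / P.B * (P.k / p) ≤ 1 * (P.k / p) :=
      mul_le_mul_of_nonneg_right (by rw [div_le_one h1]; exact P.one_le_B) hk
    simp only [Nat.cast_zero, sub_zero]
    linarith
  · rw [meanCost_decision P hx, meanNext_decision P hb hb' hx _ (P.potential_none _ _ _),
      potential_start, potential_decision P _ _ _ hx]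
    have b0 : 0 ≤ expect (π x) (bias x) := expect_nonneg _ (hb x)
    simp only [Nat.cast_zero, sub_zero, mul_zero, add_zero]
    have e : 1 + ((1 - 2 / P.T) * (P.T / 2 + P.k / p) +
        2 / P.T * ((1 / 2 - expect (π x) (bias x)) * (P.k / p))) =
        P.T / 2 + P.k / p - 2 / P.T * ((1 / 2 + expect (π x) (bias x)) * (P.k / p)) := by
      field_simp
      ring
    rw [e]
    have : 0 ≤ 2 / P.T * ((1 / 2 + expect (π x) (bias x)) * (P.k / p)) := by positivity
    linarith

theorem isProper_codePolicy (hp : 0 < p) (hp' : p ≤ 1) (hb : ∀ x a, 0 ≤ bias x a)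
    (hb' : ∀ x a, bias x a ≤ 1 / 2) : (P.ssp p code bias).IsProper (P.codePolicy code) :=
  fun x => P.hitting_lt_top_of_value_lt_top hp hp' hb hb' _ x
    ((P.value_codePolicy_le hp.le hp' hb hb' x).trans_lt ENNReal.ofReal_lt_top)

theorem Bstar_eq (hp : 0 < p) (hp' : p ≤ 1) (hb : ∀ x a, 0 ≤ bias x a)
    (hb' : ∀ x a, bias x a ≤ 1 / 2) : (P.ssp p code bias).Bstar = ENNReal.ofReal P.B := by
  refine le_antisymm (iSup_le fun x => ?_) ?_
  · exact (iInf₂_le (P.codePolicy code) (P.isProper_codePolicy hp hp' hb hb')).trans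
      (P.value_codePolicy_le hp.le hp' hb hb' x)
  · refine le_trans (le_iInf₂ fun π hπ => ?_)
      (le_iSup (P.ssp p code bias).optValue P.penalty)
    have h1 := P.B_pos
    have := SSP.le_value_of_le_bellman (P.ssp p code bias) π
      (P.potential (fun _ => 0) P.B (fun _ => 0)) rfl (K := P.B)
      (P.potential_le _ _ _ h1.le (fun _ _ => h1.le) le_rfl (fun _ => h1.le)) le_rfl (fun x => ?_)
      P.penalty (hπ _)
    · simpa [potential_penalty] using this
    rcases lt_trichotomy (x : ℕ) P.k with hx | hx | hx
    · rw [potential_lock P _ _ _ hx]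
      refine add_nonneg (add_nonneg (SSP.meanCost_nonneg _ _ _) le_rfl) ?_
      exact expect_nonneg _ fun a => expect_nonneg _
        (P.potential_nonneg _ _ _ (fun _ _ => le_rfl) h1.le fun _ => le_rfl)
    · rw [meanCost_penalty P hx, meanNext_penalty P hx, potential_start,
        potential_of_eq P _ _ _ hx]
      field_simp
      linarith
    · rw [potential_decision P _ _ _ hx]
      refine add_nonneg (add_nonneg (SSP.meanCost_nonneg _ _ _) le_rfl) ?_
      exact expect_nonneg _ fun a => expect_nonneg _
        (P.potential_nonneg _ _ _ (fun _ _ => le_rfl) h1.le fun _ => le_rfl)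

theorem payPolicy_mem_boundedPolicies (hp : 0 ≤ p) (hp' : p ≤ 1) (hb : ∀ x a, 0 ≤ bias x a)
    (hb' : ∀ x a, bias x a ≤ 1 / 2) (a : Fin (A + 1)) :
    P.payPolicy a ∈ (P.ssp p code bias).boundedPolicies P.T :=
  P.hitting_payPolicy_le hp hp' hb hb' a

theorem BstarT_le (hp : 0 ≤ p) (hp' : p ≤ 1) (hb : ∀ x a, 0 ≤ bias x a)
    (hb' : ∀ x a, bias x a ≤ 1 / 2) :
    (P.ssp p code bias).BstarT P.T ≤ ENNReal.ofReal (2 * P.BT) := by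
  have h1 := P.B_pos
  have h2 := P.BT_pos
  have h5 := P.B_le_BT
  refine iSup_le fun x => (iInf₂_le (P.payPolicy 0)
    (P.payPolicy_mem_boundedPolicies hp hp' hb hb' 0)).trans
    ((P.value_payPolicy_le hp hp' hb hb' 0 x).trans (ENNReal.ofReal_le_ofReal ?_))
  exact P.potential_le _ _ _ (by linarith) (fun _ _ => by linarith) (by linarith)
    (fun x => by nlinarith [hb x 0]) _

/-- Treat every digit that takes effect as a free exit. This happens with probability at most `p`
per step and saves at most `BT`, hence at most `BT * p * T ≤ BT / 2` in total within hitting time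
`T`. -/
theorem le_BstarT (hp : 0 ≤ p) (hp' : p ≤ 1) (hpT : p * P.T ≤ 1 / 2) :
    ENNReal.ofReal (P.BT / 2) ≤ (P.ssp p code bias).BstarT P.T := by
  have h2 := P.BT_pos
  have h3 := P.T_pos
  refine le_trans (le_iInf₂ fun π hπ => ?_) (le_iSup ((P.ssp p code bias).optValueT P.T) P.start)
  have hη : 0 ≤ P.BT * p := mul_nonneg h2.le hp
  have nn : ∀ y, 0 ≤ P.potential (fun i => if i < P.k then P.BT else 0) 0 (fun _ => 0) y :=
    P.potential_nonneg _ _ _ (fun i hi => by rw [if_pos hi]; exact h2.le) le_rfl fun _ => le_rfl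
  have := SSP.le_value_of_le_bellman (P.ssp p code bias) π
    (P.potential (fun i => if i < P.k then P.BT else 0) 0 (fun _ => 0)) rfl (K := P.BT)
    (P.potential_le _ _ _ h2.le (fun i hi => by rw [if_pos hi]) h2.le (fun _ => h2.le)) hη
    (fun x => ?_) P.start ((hπ _).trans_lt ENNReal.ofReal_lt_top)
  · rw [potential_start, if_pos P.k_pos] at this
    have h4 : ENNReal.ofReal (P.BT * p) * (P.ssp p code bias).hitting π P.start ≤
        ENNReal.ofReal (P.BT / 2) := by
      refine (mul_le_mul_right (hπ _) _).trans ?_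
      rw [← ENNReal.ofReal_mul hη]
      exact ENNReal.ofReal_le_ofReal (by nlinarith)
    have hsplit : ENNReal.ofReal P.BT = ENNReal.ofReal (P.BT / 2) + ENNReal.ofReal (P.BT / 2) := by
      rw [← ENNReal.ofReal_add (by linarith) (by linarith), add_halves]
    have h5 := this.trans (add_le_add_right h4 _)
    rw [hsplit] at h5
    have h6 := (ENNReal.add_le_add_iff_right ENNReal.ofReal_ne_top).1 h5
    simpa using h6
  have nn' : 0 ≤ (P.ssp p code bias).meanCost π x + P.BT * p + (P.ssp p code bias).meanNext π
      (P.potential (fun i => if i < P.k then P.BT else 0) 0 (fun _ => 0)) x :=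
    add_nonneg (add_nonneg (SSP.meanCost_nonneg _ _ _) hη)
      (expect_nonneg _ fun a => expect_nonneg _ nn)
  rcases lt_trichotomy (x : ℕ) P.k with hx | hx | hx
  · rw [meanCost_lock P hx, meanNext_lock P hp hp' hx, potential_none,
      potential_lock P _ _ _ hx, potential_penalty, if_pos hx]
    have q0 : 0 ≤ (π x 0 : ℝ) := NNReal.coe_nonneg _
    have q1 : 0 ≤ (π x (code ⟨x, hx⟩).succ : ℝ) * (p * (P.potential
        (fun i => if i < P.k then P.BT else 0) 0 (fun _ => 0) (P.next x) - 0)) := by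
      rw [sub_zero]
      exact mul_nonneg (NNReal.coe_nonneg _) (mul_nonneg hp (nn _))
    have e : (π x 0 : ℝ) * ((1 - 1 / P.BT) * P.BT + 1 / P.BT * 0) = π x 0 * P.BT - π x 0 := by
      field_simp
      ring
    rw [e]
    nlinarith [mul_nonneg q0 hη]
  · rwa [potential_of_eq P _ _ _ hx]
  · rwa [potential_decision P _ _ _ hx]

end LockParams

/-! ### Codes that a policy cannot guess, and the cost of missing the biased action. -/

namespace LockParams

variable {S A : ℕ} (P : LockParams S)
variable {p : ℝ} {code : Fin P.k → Fin A} {bias : Fin S → Fin (A + 1) → ℝ}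

/-- The probability that `π` tries `j` in the `i`-th state of the lock, given that it does not take
action `0`. -/
noncomputable def guess (π : Policy S (A + 1)) (i : Fin P.k) (j : Fin A) : ℝ :=
  π (P.lock i) j.succ / (1 - π (P.lock i) 0)

theorem guess_nonneg (π : Policy S (A + 1)) (i : Fin P.k) (j : Fin A) : 0 ≤ P.guess π i j := by
  rw [guess, ← sum_policy_succ]
  exact div_nonneg (NNReal.coe_nonneg _) (Finset.sum_nonneg fun _ _ => NNReal.coe_nonneg _)

theorem sum_guess_le_one (π : Policy S (A + 1)) (i : Fin P.k) : ∑ j, P.guess π i j ≤ 1 := by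
  simp only [guess]
  rw [← Finset.sum_div, sum_policy_succ]
  exact div_self_le_one _

theorem policy_succ_le (μ : stdSimplex ℝ≥0 (Fin (A + 1))) (j : Fin A) :
    (μ j.succ : ℝ) ≤ 1 - μ 0 := by
  rw [← sum_policy_succ]
  exact Finset.single_le_sum (f := fun j : Fin A => (μ j.succ : ℝ))
    (fun j _ => NNReal.coe_nonneg _) (Finset.mem_univ _)

theorem mul_guess (π : Policy S (A + 1)) (i : Fin P.k) (j : Fin A) :
    (1 - π (P.lock i) 0) * P.guess π i j = π (P.lock i) j.succ := by
  have h1 := policy_succ_le (π (P.lock i)) j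
  by_cases h : (1 - π (P.lock i) 0 : ℝ) = 0
  -- If `π` always pays here, then `guess` is `0` by division by zero, but no mass is left for the
  -- digits either.
  · rw [h] at h1 ⊢
    rw [zero_mul]
    exact le_antisymm (NNReal.coe_nonneg _) h1
  · rw [guess, mul_div_cancel₀ _ h]

theorem guess_le_one (π : Policy S (A + 1)) (i : Fin P.k) (j : Fin A) : P.guess π i j ≤ 1 :=
  (Finset.single_le_sum (f := P.guess π i) (fun j _ => P.guess_nonneg π i j)
    (Finset.mem_univ j)).trans (P.sum_guess_le_one π i)

/-- The lock with secret `code` is safe from `π`: trying to open it does not pay off. -/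
def Safe (π : Policy S (A + 1)) (code : Fin P.k → Fin A) : Prop :=
  (P.B + P.BT) * ∏ i, P.guess π i (code i) ≤ P.B

/-- A failed attempt costs `B` and leads back to the start, where value `BT` is at stake again. So
an attempt is worth `(B + BT) * (1 - ∏ guess)`, and safety says that this is no better than paying
`BT`. Hence `BT` at the start is consistent with the Bellman inequalities, and each decision state
inherits it. -/
theorem le_value_of_safe (hp : 0 ≤ p) (hp' : p ≤ 1) (hb : ∀ x a, 0 ≤ bias x a)
    (hb' : ∀ x a, bias x a ≤ 1 / 2) {π : Policy S (A + 1)} (hπ : P.Safe π code) {x : Fin S}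
    (hx : P.k < (x : ℕ)) (hfin : (P.ssp p code bias).hitting π x < ∞) :
    ENNReal.ofReal (P.BT * (1 / 2 - expect (π x) (bias x))) ≤
      (P.ssp p code bias).value π x := by
  have h1 := P.B_pos
  have h2 := P.BT_pos
  let κ : ℕ → ℝ := fun j => if h : j < P.k then P.guess π ⟨j, h⟩ (code ⟨j, h⟩) else 1
  -- The cost of an attempt resumed at digit `i`, if a failure costs `B + BT` and action `0` is not
  -- used.
  let ψ : ℕ → ℝ := fun i => (P.B + P.BT) * (1 - ∏ j ∈ Finset.Ico i P.k, κ j)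
  -- The truncation accounts for the option of paying `BT` midway.
  let g : ℕ → ℝ := fun i => min P.BT (ψ i)
  have hκ0 : ∀ j, 0 ≤ κ j := by
    intro j
    simp only [κ]
    split_ifs
    exacts [P.guess_nonneg _ _ _, zero_le_one]
  have hκ1 : ∀ j, κ j ≤ 1 := by
    intro j
    simp only [κ]
    split_ifs
    exacts [P.guess_le_one _ _ _, le_rfl]
  have hg0 : g 0 = P.BT := by
    have e : ∏ j ∈ Finset.Ico 0 P.k, κ j = ∏ i, P.guess π i (code i) := by
      rw [← Finset.range_eq_Ico, Finset.prod_range]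
      simp [κ]
    have : (P.B + P.BT) * ∏ i, P.guess π i (code i) ≤ P.B := hπ
    refine min_eq_left ?_
    simp only [ψ, e]
    linarith
  have hgk : g P.k = 0 := by simp [g, ψ, h2.le]
  have hrec : ∀ i < P.k, ψ i = κ i * ψ (i + 1) + (1 - κ i) * (P.B + P.BT) := by
    intro i hi
    simp only [ψ]
    rw [Finset.prod_eq_prod_Ico_succ_bot hi]
    ring
  have hgrec : ∀ i < P.k, g i ≤ κ i * g (i + 1) + (1 - κ i) * (P.B + P.BT) := by
    intro i hi
    rcases le_total P.BT (ψ (i + 1)) with h | h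
    · have : g (i + 1) = P.BT := min_eq_left h
      rw [this]
      have := min_le_left P.BT (ψ i)
      nlinarith [hκ1 i]
    · have : g (i + 1) = ψ (i + 1) := min_eq_right h
      rw [this, ← hrec i hi]
      exact min_le_right _ _
  have key := SSP.le_value_of_le_bellman (P.ssp p code bias) π
    (P.potential g (P.B + P.BT) (fun x => P.BT * (1 / 2 - expect (π x) (bias x)))) rfl
    (K := P.B + P.BT)
    (P.potential_le _ _ _ (by linarith) (fun i _ => (min_le_left _ _).trans (by linarith)) le_rfl
      (fun x => by nlinarith [expect_nonneg (π x) (hb x)])) le_rfl (fun x => ?_) x hfin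
  · simpa [potential_decision P _ _ _ hx] using key
  rcases lt_trichotomy (x : ℕ) P.k with hx | hx | hx
  · rw [meanCost_lock P hx, meanNext_lock P hp hp' hx, potential_none, potential_lock P _ _ _ hx,
      potential_next P _ _ hgk hx, potential_penalty]
    have q0 : 0 ≤ (π x 0 : ℝ) := NNReal.coe_nonneg _
    have q1 : (π x 0 : ℝ) ≤ 1 := by exact_mod_cast stdSimplex.le_one (π x) 0
    have e : (π x (code ⟨x, hx⟩).succ : ℝ) = (1 - π x 0) * κ x := by
      simp only [κ, dif_pos hx]
      exact (P.mul_guess π ⟨x, hx⟩ _).symm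
    rw [e]
    have a1 : g x / P.BT ≤ 1 := by
      rw [div_le_one h2]
      exact min_le_left _ _
    have a2 := mul_le_mul_of_nonneg_left a1 q0
    have a3 := mul_le_mul_of_nonneg_left (hgrec x hx) (mul_nonneg hp (sub_nonneg.2 q1))
    have e2 : (π x 0 : ℝ) * ((1 - 1 / P.BT) * g x + 1 / P.BT * 0) =
      π x 0 * g x - π x 0 * (g x / P.BT) := by ring
    rw [e2]
    linarith
  · rw [meanCost_penalty P hx, meanNext_penalty P hx, potential_start, potential_of_eq P _ _ _ hx,
      hg0]
    field_simp
    linarith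
  · rw [meanCost_decision P hx, meanNext_decision P hb hb' hx _ (P.potential_none _ _ _),
      potential_start, potential_decision P _ _ _ hx, hg0]
    exact le_of_eq (by ring)

/-- The bias `γ` at the state-action pair `q`, and none elsewhere. -/
noncomputable def biasAt (q : Fin S × Fin (A + 1)) (γ : ℝ) (x : Fin S) (a : Fin (A + 1)) : ℝ :=
  if (x, a) = q then γ else 0

theorem biasAt_nonneg (q : Fin S × Fin (A + 1)) {γ : ℝ} (hγ : 0 ≤ γ) (x : Fin S)
    (a : Fin (A + 1)) : 0 ≤ biasAt q γ x a := by
  rw [biasAt]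
  split_ifs
  exacts [hγ, le_rfl]

theorem biasAt_le_half (q : Fin S × Fin (A + 1)) {γ : ℝ} (hγ : γ ≤ 1 / 2) (x : Fin S)
    (a : Fin (A + 1)) : biasAt q γ x a ≤ 1 / 2 := by
  rw [biasAt]
  split_ifs
  exacts [hγ, by norm_num]

theorem expect_biasAt (μ : stdSimplex ℝ≥0 (Fin (A + 1))) (x : Fin S) (a : Fin (A + 1)) (γ : ℝ) :
    expect μ (biasAt (x, a) γ x) = μ a * γ := by
  simp [expect, biasAt]

/-- Paying in the lock and playing `a` has value `BT / 2 - 4 * ε` at `x`. With mass at most `1 / 2`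
on `a`, a safe policy gains at most `2 * ε` from the bias, so it is off by at least `2 * ε`. -/
theorem not_isOptimalT (hp : 0 < p) (hp' : p ≤ 1) {ε : ℝ} (hε : 0 < ε) (hε' : ε ≤ P.BT / 8)
    {π : Policy S (A + 1)} (hπ : P.Safe π code) {x : Fin S} (hx : P.k < (x : ℕ))
    {a : Fin (A + 1)} (ha : (π x a : ℝ) ≤ 1 / 2) :
    ¬ (P.ssp p code (biasAt (x, a) (4 * ε / P.BT))).IsOptimalT ε P.T π := by
  intro hopt
  have h1 := P.B_pos
  have h2 := P.BT_pos
  have hγ0 : 0 ≤ 4 * ε / P.BT := by positivity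
  have hγ1 : 4 * ε / P.BT ≤ 1 / 2 := by
    rw [div_le_iff₀ h2]
    linarith
  have hb := biasAt_nonneg (x, a) hγ0
  have hb' := biasAt_le_half (x, a) hγ1
  have hbound : (P.ssp p code (biasAt (x, a) (4 * ε / P.BT))).value π x ≤
      ENNReal.ofReal (P.BT * (1 / 2 - 4 * ε / P.BT)) + ENNReal.ofReal ε := by
    refine (hopt x).trans (add_le_add_left ?_ _)
    refine (iInf₂_le (P.payPolicy a)
      (P.payPolicy_mem_boundedPolicies hp.le hp' hb hb' a)).trans ?_
    refine (P.value_payPolicy_le hp.le hp' hb hb' a x).trans_eq ?_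
    rw [potential_decision P _ _ _ hx, biasAt, if_pos rfl]
  have hfin := P.hitting_lt_top_of_value_lt_top hp hp' hb hb' π x
    (hbound.trans_lt (ENNReal.add_lt_top.2 ⟨ENNReal.ofReal_lt_top, ENNReal.ofReal_lt_top⟩))
  have h3 := (P.le_value_of_safe hp.le hp' hb hb' hπ hx hfin).trans hbound
  have h4 : 0 ≤ P.BT * (1 / 2 - 4 * ε / P.BT) := mul_nonneg h2.le (by linarith)
  rw [← ENNReal.ofReal_add h4 hε.le, ENNReal.ofReal_le_ofReal_iff (by linarith), expect_biasAt] at h3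
  have e1 : P.BT * (1 / 2 - 4 * ε / P.BT) = P.BT / 2 - 4 * ε := by field_simp
  have e2 : P.BT * (1 / 2 - π x a * (4 * ε / P.BT)) = P.BT / 2 - 4 * ε * π x a := by field_simp
  rw [e1, e2] at h3
  nlinarith

theorem expect_trans_le_add (hp : 0 ≤ p) (hp' : p ≤ 1) (code' : Fin P.k → Fin A)
    (q : Fin S × Fin (A + 1)) {f : Option (Fin S) → ℝ} (h0 : ∀ y, 0 ≤ f y) (h1 : ∀ y, f y ≤ 1) :
    expect ((P.ssp p code bias).trans q.1 q.2) f ≤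
      expect ((P.ssp 0 code' bias).trans q.1 q.2) f + p ∧
    expect ((P.ssp 0 code' bias).trans q.1 q.2) f ≤
      expect ((P.ssp p code bias).trans q.1 q.2) f + p := by
  obtain ⟨x, a⟩ := q
  dsimp only
  rcases lt_trichotomy (x : ℕ) P.k with hx | hx | hx
  · refine Fin.cases ?_ (fun j => ?_) a
    · simp only [expect_trans_lock_zero P hx]
      constructor <;> linarith
    · rw [expect_trans_lock_succ P hp hp' hx, expect_trans_lock_succ P le_rfl zero_le_one hx]
      simp only [← apply_ite f]
      constructor <;> nlinarith [h0 (some x), h1 (some x),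
        h0 (if j = code ⟨x, hx⟩ then P.next x else some P.penalty),
        h1 (if j = code ⟨x, hx⟩ then P.next x else some P.penalty)]
  · simp only [expect_trans_penalty P hx]
    constructor <;> linarith
  · simp only [trans_decision P hx]
    constructor <;> linarith

/-- The dual form of a relative entropy bound: the laws differ only once the state is left, with
probability `2 / T`, and there a fair coin is compared with one of bias `γ`. -/
theorem expect_decisionLaw_log_le (x : Fin S) {γ : ℝ} (hγ : 0 ≤ γ) (hγ' : γ ≤ 1 / 4)
    {g : Option (Fin S) → ℝ} (hg : ∀ y, 0 < g y) :
    expect (P.decisionLaw x 0) (fun y => Real.log (g y)) ≤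
      8 * γ ^ 2 / P.T + Real.log (expect (P.decisionLaw x γ) g) := by
  have hu0 : 0 ≤ 2 / P.T := div_nonneg zero_le_two P.T_pos.le
  have hu1 := P.two_div_T_le_one
  rw [expect_decisionLaw P x le_rfl (by norm_num), expect_decisionLaw P x hγ (by linarith)]
  set u := 2 / P.T with hu
  have hD : 8 * γ ^ 2 / P.T = u * (4 * γ ^ 2) := by rw [hu]; ring
  rw [hD]
  have ha := hg (some x)
  have hb := hg none
  have hc := hg (some P.start)
  set a := g (some x)
  set b := g none
  set c := g (some P.start)
  have hb2 : 0 < (1 + 2 * γ) * b := mul_pos (by linarith) hb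
  have hc2 : 0 < (1 - 2 * γ) * c := mul_pos (by linarith) hc
  have hm : (1 / 2 + γ) * b + (1 / 2 - γ) * c =
      1 / 2 * ((1 + 2 * γ) * b) + 1 / 2 * ((1 - 2 * γ) * c) := by ring
  have hm0 : 0 < (1 / 2 + γ) * b + (1 / 2 - γ) * c := by rw [hm]; positivity
  have j1 := strictConcaveOn_log_Ioi.concaveOn.2 (Set.mem_Ioi.2 ha) (Set.mem_Ioi.2 hm0)
    (sub_nonneg.2 hu1) hu0 (by ring)
  have j2 := strictConcaveOn_log_Ioi.concaveOn.2 (Set.mem_Ioi.2 hb2) (Set.mem_Ioi.2 hc2)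
    (show (0 : ℝ) ≤ 1 / 2 by norm_num) (show (0 : ℝ) ≤ 1 / 2 by norm_num) (by norm_num)
  simp only [smul_eq_mul] at j1 j2
  rw [← hm, Real.log_mul (by linarith) hb.ne', Real.log_mul (by linarith) hc.ne'] at j2
  -- From `log t ≥ 1 - 1 / t` at `t = 1 - 4 * γ ^ 2`; the bound on its inverse uses `γ ≤ 1 / 4`.
  have j3 : -(8 * γ ^ 2) ≤ Real.log (1 + 2 * γ) + Real.log (1 - 2 * γ) := by
    rw [← Real.log_mul (by linarith) (by linarith)]
    have hpos : 0 < (1 + 2 * γ) * (1 - 2 * γ) := mul_pos (by linarith) (by linarith)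
    refine le_trans ?_ (Real.one_sub_inv_le_log_of_pos hpos)
    have : ((1 + 2 * γ) * (1 - 2 * γ))⁻¹ ≤ 1 + 8 * γ ^ 2 := by
      rw [inv_le_iff_one_le_mul₀ hpos]
      nlinarith [mul_nonneg hγ hγ, mul_nonneg (mul_nonneg hγ hγ) (sub_nonneg.2 hγ')]
    linarith
  have j4 := mul_le_mul_of_nonneg_left (a := u)
    (show 1 / 2 * Real.log b + 1 / 2 * Real.log c ≤
      4 * γ ^ 2 + Real.log ((1 / 2 + γ) * b + (1 / 2 - γ) * c) by linarith) hu0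
  linarith

theorem sum_prod_guess_le_one (π : Policy S (A + 1)) :
    ∑ code : Fin P.k → Fin A, ∏ i, P.guess π i (code i) ≤ 1 := by
  have := Finset.prod_univ_sum (fun _ : Fin P.k => (Finset.univ : Finset (Fin A)))
    (fun i j => P.guess π i j)
  rw [Fintype.piFinset_univ] at this
  rw [← this]
  exact Finset.prod_le_one (fun i _ => Finset.sum_nonneg fun j _ => P.guess_nonneg π i j)
    fun i _ => P.sum_guess_le_one π i

open Classical in
-- Markov's inequality: the guessing probabilities of all codes sum to at most `1`, while an unsafe
-- code has one above `B / (B + BT)`. So at most `(B + BT) / B ≤ 2 * BT / B ≤ A ^ k / 2` codes are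
-- unsafe.
theorem card_le_two_mul_card_safe (hA : 4 * P.BT ≤ P.B * (A : ℝ) ^ P.k) (π : Policy S (A + 1)) :
    A ^ P.k ≤ 2 * (Finset.univ.filter fun code : Fin P.k → Fin A => P.Safe π code).card := by
  have h1 := P.B_pos
  have h2 := P.BT_pos
  have hcard := Finset.card_filter_add_card_filter_not (s := Finset.univ)
    (fun code : Fin P.k → Fin A => P.Safe π code)
  have htot : (Finset.univ : Finset (Fin P.k → Fin A)).card = A ^ P.k := by simp
  rw [htot] at hcard
  have hsum : (Finset.univ.filter fun code : Fin P.k → Fin A => ¬ P.Safe π code).card * P.B ≤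
      P.B + P.BT := by
    calc _ = ∑ code ∈ Finset.univ.filter fun code : Fin P.k → Fin A => ¬ P.Safe π code, P.B := by
          simp
      _ ≤ ∑ code ∈ Finset.univ.filter fun code : Fin P.k → Fin A => ¬ P.Safe π code,
          (P.B + P.BT) * ∏ i, P.guess π i (code i) :=
          Finset.sum_le_sum fun code hc => (not_le.1 (Finset.mem_filter.1 hc).2).le
      _ ≤ ∑ code : Fin P.k → Fin A, (P.B + P.BT) * ∏ i, P.guess π i (code i) :=
          Finset.sum_le_sum_of_subset_of_nonneg (Finset.filter_subset _ _) fun code _ _ =>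
            mul_nonneg (by linarith) (Finset.prod_nonneg fun i _ => P.guess_nonneg π i _)
      _ ≤ P.B + P.BT := by
          rw [← Finset.mul_sum]
          exact mul_le_of_le_one_right (by linarith) (P.sum_prod_guess_le_one π)
  have h3 : 2 * ((Finset.univ.filter fun code : Fin P.k → Fin A => ¬ P.Safe π code).card : ℝ) ≤
      (A : ℝ) ^ P.k := by
    have h4 := P.B_le_BT
    refine le_of_mul_le_mul_left (a := P.B) ?_ h1
    linarith
  have h5 : 2 * (Finset.univ.filter fun code : Fin P.k → Fin A => ¬ P.Safe π code).card ≤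
      A ^ P.k := by exact_mod_cast h3
  omega

theorem measurable_policy_apply (x : Fin S) (a : Fin (A + 1)) :
    Measurable fun π : Policy S (A + 1) => (π x a : ℝ) := by
  have : Measurable fun π : Policy S (A + 1) => (π x : Fin (A + 1) → ℝ≥0) a :=
    (measurable_pi_apply a).comp (measurable_subtype_coe.comp (measurable_pi_apply x))
  exact this.coe_nnreal_real

theorem measurableSet_safe (code : Fin P.k → Fin A) :
    MeasurableSet {π : Policy S (A + 1) | P.Safe π code} := by
  refine measurableSet_le (Measurable.const_mul (Finset.measurable_prod _ fun i _ => ?_) _)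
    measurable_const
  exact (measurable_policy_apply _ _).div (measurable_const.sub (measurable_policy_apply _ _))

end LockParams

/-! ### Averaging a probability over a family of events. -/

namespace Learner

open MeasureTheory Classical

/-- Double counting. It serves twice: for the codes safe from a policy, and for the actions that a
policy misses. -/
theorem mul_prob_le_sum {S A : ℕ} (L : Learner S A) (M : SSP S A) {ι : Type*} [Fintype ι]
    {E : Set (Policy S A)} (hE : MeasurableSet E) {F : ι → Set (Policy S A)}
    (hF : ∀ i, MeasurableSet (F i)) {c : ℕ}
    (hc : ∀ π ∈ E, c ≤ (Finset.univ.filter fun i => π ∈ F i).card) (n : ℕ) (h : History S A) :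
    c * L.prob M E n h ≤ ∑ i, L.prob M (F i) n h := by
  have hfin := fun i => (L.outputLawFrom_lt_top M n h (F i)).ne
  have key : (c : ℝ≥0∞) * L.outputLawFrom M n h E ≤ ∑ i, L.outputLawFrom M n h (F i) := by
    calc _ = ∫⁻ π, E.indicator (fun _ => (c : ℝ≥0∞)) π ∂L.outputLawFrom M n h := by
          rw [lintegral_indicator_const hE]
      _ ≤ ∫⁻ π, ∑ i, (F i).indicator 1 π ∂L.outputLawFrom M n h := by
          refine lintegral_mono fun π => ?_
          by_cases hπ : π ∈ E
          · simp only [Set.indicator_of_mem hπ]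
            have : ∑ i, (F i).indicator (1 : Policy S A → ℝ≥0∞) π =
                (Finset.univ.filter fun i => π ∈ F i).card := by
              simp [Set.indicator_apply]
            rw [this]
            exact_mod_cast hc π hπ
          · simp [hπ]
      _ = ∑ i, L.outputLawFrom M n h (F i) := by
          rw [lintegral_finsetSum _ fun i _ => measurable_one.indicator (hF i)]
          simp [hF]
  have := ENNReal.toReal_mono (ENNReal.sum_ne_top.2 fun i _ => hfin i) key
  rwa [ENNReal.toReal_mul, ENNReal.toReal_sum fun i _ => hfin i, ENNReal.toReal_natCast] at this

end Learner

/-! ### The best-arm lower bound on the number of samples. -/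

namespace LockParams

variable {S A : ℕ} (P : LockParams S)

/-- The policies that do not take the action of `q` with probability more than `1 / 2` in its
state. -/
def missing (q : Fin S × Fin (A + 1)) : Set (Policy S (A + 1)) := {π | (π q.1 q.2 : ℝ) ≤ 1 / 2}

theorem measurableSet_missing (q : Fin S × Fin (A + 1)) : MeasurableSet (missing q) :=
  measurableSet_le (measurable_policy_apply _ _) measurable_const

open Classical in
theorem le_card_missing (π : Policy S (A + 1)) (x : Fin S) :
    A ≤ (Finset.univ.filter fun a => π ∈ missing (x, a)).card := by
  have hcard := Finset.card_filter_add_card_filter_not (s := Finset.univ)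
    (fun a : Fin (A + 1) => π ∈ missing (x, a))
  have hle : (Finset.univ.filter fun a : Fin (A + 1) => ¬ π ∈ missing (x, a)).card ≤ 1 := by
    refine Finset.card_le_one.2 fun a ha b hb => ?_
    have ha' : (1 / 2 : ℝ) < π x a := not_le.1 (Finset.mem_filter.1 ha).2
    have hb' : (1 / 2 : ℝ) < π x b := not_le.1 (Finset.mem_filter.1 hb).2
    by_contra hab
    have h1 := Finset.sum_le_sum_of_subset_of_nonneg (f := fun a => (π x a : ℝ))
      (Finset.subset_univ {a, b}) fun _ _ _ => NNReal.coe_nonneg _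
    rw [Finset.sum_pair hab, sum_coe_stdSimplex] at h1
    linarith
  simp only [Finset.card_univ, Fintype.card_fin] at hcard
  omega

open Classical in
-- For each code, correctness at `p > 0` bounds the probability of missing `q` while being safe by
-- `δ`, and passing to `p = 0` adds `n * p ≤ δ`. At `p = 0` the model does not involve the code, so
-- averaging over all codes, at least half of them safe, gives `4 * δ`. Correctness cannot be used
-- at `p = 0` itself, where staying in the lock forever is free.
theorem prob_missing_le (hA : 4 * P.BT ≤ P.B * (A : ℝ) ^ P.k) {p : ℝ} (hp : 0 < p) (hp' : p ≤ 1)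
    {ε δ : ℝ} (hε : 0 < ε) (hε' : ε ≤ P.BT / 8) {L : Learner S (A + 1)}
    (hL : L.IsCorrect ε δ P.T) {n : ℕ} (hn : n * p ≤ δ) (code₀ : Fin P.k → Fin A)
    (q : Fin S × Fin (A + 1)) (hq : P.k < (q.1 : ℕ)) :
    L.prob (P.ssp 0 code₀ (biasAt q (4 * ε / P.BT))) (missing q) n [] ≤ 4 * δ := by
  obtain ⟨x, a⟩ := q
  have hApos : 0 < A := (code₀ ⟨0, P.k_pos⟩).pos
  have h2 := P.BT_pos
  have hγ0 : 0 ≤ 4 * ε / P.BT := by positivity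
  have hγ1 : 4 * ε / P.BT ≤ 1 / 2 := by
    rw [div_le_iff₀ h2]
    linarith
  have hb := biasAt_nonneg (x, a) hγ0
  have hb' := biasAt_le_half (x, a) hγ1
  have hmeas : ∀ code : Fin P.k → Fin A,
      MeasurableSet (missing (x, a) ∩ {π : Policy S (A + 1) | P.Safe π code}) :=
    fun code => (measurableSet_missing _).inter (P.measurableSet_safe code)
  have each : ∀ code : Fin P.k → Fin A, L.prob (P.ssp 0 code₀ (biasAt (x, a) (4 * ε / P.BT)))
      (missing (x, a) ∩ {π | P.Safe π code}) n [] ≤ 2 * δ := by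
    intro code
    have h1 := hL.prob_le (M := P.ssp p code (biasAt (x, a) (4 * ε / P.BT)))
      ⟨_, P.isProper_codePolicy hp hp' hb hb'⟩ (hmeas code)
      (fun π hπ => P.not_isOptimalT hp hp' hε hε' hπ.2 hq hπ.1) n
    have h3 := L.prob_le_prob_add (M := P.ssp 0 code₀ (biasAt (x, a) (4 * ε / P.BT)))
      (P.cost_eq_cost p code (biasAt (x, a) (4 * ε / P.BT))) hp.le
      (fun q f h0 h1 => (P.expect_trans_le_add hp.le hp' code₀ q h0 h1).2)
      (missing (x, a) ∩ {π | P.Safe π code}) n []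
    linarith
  -- Half of the codes, rounded up so that no factor is lost when `A ^ k` is odd.
  have hcard : ∀ π ∈ missing (x, a), (A ^ P.k + 1) / 2 ≤ (Finset.univ.filter
      fun code => π ∈ missing (x, a) ∩ {π : Policy S (A + 1) | P.Safe π code}).card := by
    intro π hπ
    have h1 := P.card_le_two_mul_card_safe hA π
    have h3 : (Finset.univ.filter fun code : Fin P.k → Fin A => P.Safe π code) ⊆
        Finset.univ.filter
          fun code => π ∈ missing (x, a) ∩ {π : Policy S (A + 1) | P.Safe π code} :=
      fun code hc => Finset.mem_filter.2 ⟨Finset.mem_univ _, hπ, (Finset.mem_filter.1 hc).2⟩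
    have h4 := Finset.card_le_card h3
    omega
  have hcount := L.mul_prob_le_sum (P.ssp 0 code₀ (biasAt (x, a) (4 * ε / P.BT)))
    (measurableSet_missing (x, a)) hmeas (c := (A ^ P.k + 1) / 2)
    (fun π hπ => by convert hcard π hπ) n []
  have hsum := hcount.trans (Finset.sum_le_sum fun code _ => each code)
  simp only [Finset.sum_const, Finset.card_univ, Fintype.card_fun, Fintype.card_fin,
    nsmul_eq_mul] at hsum
  have hhalf : (((A ^ P.k : ℕ) : ℝ)) ≤ 2 * (((A ^ P.k + 1) / 2 : ℕ) : ℝ) := by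
    have : A ^ P.k ≤ 2 * ((A ^ P.k + 1) / 2) := by omega
    exact_mod_cast this
  have hpos : (0 : ℝ) < ((A ^ P.k : ℕ) : ℝ) := by exact_mod_cast pow_pos hApos _
  have h0 := L.prob_nonneg (P.ssp 0 code₀ (biasAt (x, a) (4 * ε / P.BT))) (missing (x, a)) n []
  refine le_of_mul_le_mul_left (a := ((A ^ P.k : ℕ) : ℝ)) ?_ hpos
  nlinarith [mul_le_mul_of_nonneg_right hhalf h0]

/-- The change of measure from no bias to a bias at `q`. The choice `exp l = 1 / (4 * δ)` cancels
the bound `4 * δ` in the biased model, so the last logarithm is at most `log 2`. -/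
theorem log_le_queries (hA : 4 * P.BT ≤ P.B * (A : ℝ) ^ P.k) {p : ℝ} (hp : 0 < p) (hp' : p ≤ 1)
    {ε δ : ℝ} (hε : 0 < ε) (hε' : ε ≤ P.BT / 16) (hδ : 0 < δ) (hδ' : δ ≤ 1 / 4)
    {L : Learner S (A + 1)} (hL : L.IsCorrect ε δ P.T) {n : ℕ} (hn : n * p ≤ δ)
    (code₀ : Fin P.k → Fin A) (q : Fin S × Fin (A + 1)) (hq : P.k < (q.1 : ℕ)) :
    Real.log (1 / (4 * δ)) * L.prob (P.ssp 0 code₀ 0) (missing q) n [] ≤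
      8 * (4 * ε / P.BT) ^ 2 / P.T * L.queries (P.ssp 0 code₀ 0) q n [] + Real.log 2 := by
  have h2 := P.BT_pos
  have hγ0 : 0 ≤ 4 * ε / P.BT := by positivity
  have hγ1 : 4 * ε / P.BT ≤ 1 / 4 := by
    rw [div_le_iff₀ h2]
    linarith
  have h4δ : 0 < 1 / (4 * δ) := by positivity
  have hle : 1 ≤ 1 / (4 * δ) := by
    rw [le_div_iff₀ (by positivity)]
    linarith
  have key := L.mul_prob_le_queries
    (P.cost_eq_cost (p := 0) (code := code₀) (bias := 0) 0 code₀ (biasAt q (4 * ε / P.BT))) q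
    (D := 8 * (4 * ε / P.BT) ^ 2 / P.T) (Real.log_nonneg hle)
    (fun r hr => by
      rcases lt_trichotomy (r.1 : ℕ) P.k with hx | hx | hx
      · refine Fin.cases ?_ (fun j => ?_) r.2
        · rw [trans_lock_zero P hx, trans_lock_zero P hx]
        · rw [trans_lock_succ P hx, trans_lock_succ P hx]
      · rw [trans_penalty P hx, trans_penalty P hx]
      · rw [trans_decision P hx, trans_decision P hx, biasAt, if_neg (by simpa using hr)]
        rfl)
    (fun g hg => by
      rw [trans_decision P hq, trans_decision P hq, biasAt, if_pos rfl]
      exact P.expect_decisionLaw_log_le q.1 hγ0 hγ1 hg)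
    (missing q) n []
  refine key.trans (add_le_add_right (Real.log_le_log ?_ ?_) _)
  · have := mul_nonneg (sub_nonneg.2 (Real.one_le_exp (Real.log_nonneg hle)))
      (L.prob_nonneg (P.ssp 0 code₀ (biasAt q (4 * ε / P.BT))) (missing q) n [])
    linarith
  · rw [Real.exp_log h4δ]
    have h3 := P.prob_missing_le hA hp hp' hε (by linarith) hL hn code₀ q hq
    have h5 := mul_le_mul_of_nonneg_left h3 (sub_nonneg.2 hle)
    have h6 : (1 / (4 * δ) - 1) * (4 * δ) = 1 - 4 * δ := by field_simp
    linarith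

theorem card_decision : (Finset.univ.filter fun x : Fin S => P.k < (x : ℕ)).card = S - 1 - P.k := by
  have h1 := Fin.card_filter_val_lt (n := S) (m := P.k + 1)
  have h2 := Finset.card_filter_add_card_filter_not (s := Finset.univ)
    (fun x : Fin S => (x : ℕ) < P.k + 1)
  simp only [not_lt, Nat.succ_le_iff, Finset.card_univ, Fintype.card_fin, h1] at h2
  have h3 := P.k_lt
  omega

theorem log_mul_card_le (hA : 4 * P.BT ≤ P.B * (A : ℝ) ^ P.k) {p : ℝ} (hp : 0 < p) (hp' : p ≤ 1)
    {ε δ : ℝ} (hε : 0 < ε) (hε' : ε ≤ P.BT / 16) (hδ : 0 < δ) (hδ' : δ ≤ 1 / 4)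
    {L : Learner S (A + 1)} (hL : L.IsCorrect ε δ P.T) {n : ℕ} (hn : n * p ≤ δ)
    (code₀ : Fin P.k → Fin A) (hs : L.SampleComplexityLE (P.ssp p code₀ 0) δ n) :
    (S - 1 - P.k : ℕ) * (Real.log (1 / (4 * δ)) * (A * (1 - 2 * δ)) - (A + 1) * Real.log 2) ≤
      8 * (4 * ε / P.BT) ^ 2 / P.T * n := by
  have hT := P.T_pos
  -- One `δ` is lost by the learner and one by replacing `p` by `0`.
  have hterm : 1 - 2 * δ ≤ L.prob (P.ssp 0 code₀ 0) Set.univ n [] := by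
    have h1 : ENNReal.ofReal (1 - δ) ≤ L.outputLaw (P.ssp p code₀ 0) n Set.univ := hs
    rw [L.outputLaw_eq_ofReal_prob, ENNReal.ofReal_le_ofReal_iff (L.prob_nonneg _ _ _ _)] at h1
    have h3 := L.prob_le_prob_add (P.cost_eq_cost (p := p) (code := code₀) (bias := 0) 0 code₀ 0)
      hp.le (fun q f h0 h1 => (P.expect_trans_le_add hp.le hp' code₀ q h0 h1).1) Set.univ n []
    linarith
  have hl : 0 ≤ Real.log (1 / (4 * δ)) := by
    refine Real.log_nonneg ?_
    rw [le_div_iff₀ (by positivity)]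
    linarith
  have hstate : ∀ x ∈ Finset.univ.filter fun x : Fin S => P.k < (x : ℕ),
      Real.log (1 / (4 * δ)) * (A * (1 - 2 * δ)) - (A + 1) * Real.log 2 ≤
      8 * (4 * ε / P.BT) ^ 2 / P.T * ∑ a, L.queries (P.ssp 0 code₀ 0) (x, a) n [] := by
    intro x hx
    have h1 := L.mul_prob_le_sum (P.ssp 0 code₀ 0) MeasurableSet.univ
      (fun a => measurableSet_missing (x, a)) (fun π _ => le_card_missing π x) n []
    have h2 := Finset.sum_le_sum fun a (_ : a ∈ (Finset.univ : Finset (Fin (A + 1)))) =>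
      P.log_le_queries hA hp hp' hε hε' hδ hδ' hL hn code₀ (x, a) (Finset.mem_filter.1 hx).2
    rw [Finset.sum_add_distrib, ← Finset.mul_sum, ← Finset.mul_sum, Finset.sum_const,
      Finset.card_univ, Fintype.card_fin, nsmul_eq_mul] at h2
    push_cast at h2
    have h3 := mul_le_mul_of_nonneg_left
      ((mul_le_mul_of_nonneg_left hterm (Nat.cast_nonneg A)).trans h1) hl
    linarith
  have hsum := Finset.sum_le_sum hstate
  rw [Finset.sum_const, nsmul_eq_mul, P.card_decision, ← Finset.mul_sum] at hsum
  refine hsum.trans (mul_le_mul_of_nonneg_left ?_ (by positivity))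
  refine le_trans ?_ (L.sum_queries_le (P.ssp 0 code₀ 0) n [])
  rw [Fintype.sum_prod_type]
  exact Finset.sum_le_sum_of_subset_of_nonneg (Finset.filter_subset _ _) fun x _ _ =>
    Finset.sum_nonneg fun a _ => L.queries_nonneg _ _ _ _

theorem le_mul_samples (hA : 4 * P.BT ≤ P.B * (A : ℝ) ^ P.k) (hA2 : 2 ≤ A)
    (hS : S ≤ 3 * (S - 1 - P.k)) {p : ℝ} (hp : 0 < p) (hp' : p ≤ 1)
    {ε δ : ℝ} (hε : 0 < ε) (hε' : ε ≤ P.BT / 16) (hδ : 0 < δ) (hδ' : δ < 1 / (8 * Real.exp 4))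
    {L : Learner S (A + 1)} (hL : L.IsCorrect ε δ P.T) {n : ℕ} (hn : n * p ≤ δ)
    (code₀ : Fin P.k → Fin A) (hs : L.SampleComplexityLE (P.ssp p code₀ 0) δ n) :
    P.T * P.BT ^ 2 * S * (A + 1 : ℕ) / ε ^ 2 * Real.log (1 / δ) ≤ 2560 * n := by
  have hT := P.T_pos
  have hBT := P.BT_pos
  have he : (5 : ℝ) ≤ Real.exp 4 := by linarith [Real.add_one_le_exp 4]
  have hδ40 : δ ≤ 1 / 40 := hδ'.le.trans
    (one_div_le_one_div_of_le (by norm_num) (by linarith))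
  have main := P.log_mul_card_le hA hp hp' hε hε' hδ (by linarith) hL hn code₀ hs
  set l := Real.log (1 / (4 * δ)) with hl
  -- This is where `δ < 1 / (8 * exp 4)` enters: with `l ≥ 4`, the `log 2` terms are at most `7 / 40
  -- * l`.
  have h4 : 4 ≤ l := by
    rw [hl, Real.le_log_iff_exp_le (by positivity), le_div_iff₀ (by positivity)]
    rw [lt_div_iff₀ (by positivity)] at hδ'
    nlinarith [Real.exp_pos 4]
  have hlog : Real.log (1 / δ) ≤ 2 * l := by
    have e : Real.log (1 / δ) = l + 2 * Real.log 2 := by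
      rw [hl, show 1 / δ = 1 / (4 * δ) * 2 ^ 2 by field_simp; norm_num,
        Real.log_mul (by positivity) (by positivity), Real.log_pow]
      norm_num
    linarith [Real.log_two_lt_d9]
  have hA' : (2 : ℝ) ≤ A := by exact_mod_cast hA2
  have hS' : (S : ℝ) ≤ 3 * (S - 1 - P.k : ℕ) := by exact_mod_cast hS
  set m : ℝ := ((S - 1 - P.k : ℕ) : ℝ)
  have hm : 0 ≤ m := Nat.cast_nonneg _
  have h5 : 2 / 5 * l * (A + 1) ≤ l * (A * (1 - 2 * δ)) - (A + 1) * Real.log 2 := by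
    have h6 : (A : ℝ) * (19 / 20) ≤ A * (1 - 2 * δ) :=
      mul_le_mul_of_nonneg_left (by linarith) (by linarith)
    have h7 := mul_le_mul_of_nonneg_left h6 (show 0 ≤ l by linarith)
    have h8 : (A + 1 : ℝ) * Real.log 2 ≤ (A + 1) * (7 / 40 * l) :=
      mul_le_mul_of_nonneg_left (by linarith [Real.log_two_lt_d9]) (by linarith)
    nlinarith
  have h9 := (mul_le_mul_of_nonneg_left h5 hm).trans main
  have h10 : (S : ℝ) * (A + 1) * Real.log (1 / δ) ≤ 3 * m * (A + 1) * (2 * l) := by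
    have hl0 : 0 ≤ Real.log (1 / δ) := Real.log_nonneg (by
      rw [le_div_iff₀ hδ]
      linarith)
    gcongr
  have h11 : (S : ℝ) * (A + 1) * Real.log (1 / δ) ≤
      15 * (8 * (4 * ε / P.BT) ^ 2 / P.T * n) := by linarith
  have e1 : P.T * P.BT ^ 2 * S * (A + 1 : ℕ) / ε ^ 2 * Real.log (1 / δ) =
      P.T * P.BT ^ 2 / ε ^ 2 * (S * (A + 1) * Real.log (1 / δ)) := by
    push_cast
    ring
  have e2 : P.T * P.BT ^ 2 / ε ^ 2 * (15 * (8 * (4 * ε / P.BT) ^ 2 / P.T * n)) = 1920 * n := by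
    field_simp
    ring
  rw [e1]
  refine (mul_le_mul_of_nonneg_left h11 (by positivity)).trans ?_
  rw [e2]
  have : (0 : ℝ) ≤ n := Nat.cast_nonneg n
  linarith

theorem cmin_eq_zero {p : ℝ} {code : Fin P.k → Fin A} {bias : Fin S → Fin (A + 1) → ℝ}
    (hA : 0 < A) : (P.ssp p code bias).cmin = 0 := by
  refine le_antisymm ?_ zero_le
  refine (ciInf_le (OrderBot.bddBelow _) P.start).trans ?_
  refine (ciInf_le (OrderBot.bddBelow _) (Fin.succ ⟨0, hA⟩)).trans ?_
  rw [cost_lock_succ P (x := P.start) P.k_pos]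

end LockParams

/-! ### Choice of `p` and conclusion. -/

theorem exists_hard_instance {S A : ℕ} (P : LockParams S)
    (hA : 4 * P.BT ≤ P.B * (A : ℝ) ^ P.k) (hA2 : 2 ≤ A) (hS : S ≤ 3 * (S - 1 - P.k))
    {ε δ : ℝ} (hε : 0 < ε) (hε' : ε ≤ P.BT / 16) (hδ : 0 < δ) (hδ' : δ < 1 / (8 * Real.exp 4))
    (L : Learner S (A + 1)) (hL : L.IsCorrect ε δ P.T) :
    ∃ M : SSP S (A + 1), (∃ π, M.IsProper π) ∧ M.cmin = 0 ∧ M.Bstar = ENNReal.ofReal P.B ∧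
      ENNReal.ofReal (P.BT / 2) ≤ M.BstarT P.T ∧ M.BstarT P.T ≤ ENNReal.ofReal (2 * P.BT) ∧
      ∀ n : ℕ, L.SampleComplexityLE M δ n →
        1 / 10240 * (P.T * (M.BstarT P.T).toReal ^ 2 * S * (A + 1 : ℕ) / ε ^ 2 *
          Real.log (1 / δ)) ≤ n := by
  have hT := P.T_pos
  have hBT := P.BT_pos
  -- `p` has to be fixed before `n` is known. Sample sizes `n ≥ N` satisfy the bound trivially, so
  -- `n * p ≤ δ` is needed only for `n ≤ N`.
  obtain ⟨N, hN⟩ := exists_nat_ge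
    (1 / 2560 * (P.T * P.BT ^ 2 * S * (A + 1 : ℕ) / ε ^ 2 * Real.log (1 / δ)))
  have hN1 : (0 : ℝ) < N + 1 := by positivity
  obtain ⟨p, hp, hpδ, hpT⟩ : ∃ p : ℝ, 0 < p ∧ p * (N + 1) ≤ δ ∧ p * P.T ≤ 1 / 2 := by
    refine ⟨min (δ / (N + 1)) (1 / (2 * P.T)), by positivity, ?_, ?_⟩
    · rw [← le_div_iff₀ hN1]
      exact min_le_left _ _
    · rw [← le_div_iff₀ hT]
      refine (min_le_right _ _).trans_eq ?_
      field_simp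
  have hp' : p ≤ 1 := by nlinarith [P.two_le_BT, P.six_mul_BT_le_T]
  let code : Fin P.k → Fin A := fun _ => ⟨0, by omega⟩
  have hb : ∀ (x : Fin S) (a : Fin (A + 1)), 0 ≤ (0 : Fin S → Fin (A + 1) → ℝ) x a :=
    fun _ _ => le_rfl
  have hb' : ∀ (x : Fin S) (a : Fin (A + 1)), (0 : Fin S → Fin (A + 1) → ℝ) x a ≤ 1 / 2 :=
    fun _ _ => by norm_num
  have hle := P.BstarT_le (code := code) hp.le hp' hb hb'
  refine ⟨P.ssp p code 0, ⟨_, P.isProper_codePolicy hp hp' hb hb'⟩,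
    P.cmin_eq_zero (by omega), P.Bstar_eq hp hp' hb hb', P.le_BstarT hp.le hp' hpT, hle,
    fun n hn => ?_⟩
  have hreal : ((P.ssp p code 0).BstarT P.T).toReal ≤ 2 * P.BT :=
    ENNReal.toReal_le_of_le_ofReal (by linarith) hle
  have hlog : 0 ≤ Real.log (1 / δ) := Real.log_nonneg (by
    rw [le_div_iff₀ hδ, one_mul]
    refine hδ'.le.trans ?_
    rw [div_le_one (by positivity)]
    linarith [Real.add_one_le_exp 4])
  -- The constant is `2560 * 4`, since `B_{⋆,T} ≤ 2 * BT` enters squared.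
  have hupper : 1 / 10240 * (P.T * ((P.ssp p code 0).BstarT P.T).toReal ^ 2 * S * (A + 1 : ℕ) /
      ε ^ 2 * Real.log (1 / δ)) ≤
      1 / 2560 * (P.T * P.BT ^ 2 * S * (A + 1 : ℕ) / ε ^ 2 * Real.log (1 / δ)) := by
    calc _ ≤ 1 / 10240 * (P.T * (2 * P.BT) ^ 2 * S * (A + 1 : ℕ) / ε ^ 2 * Real.log (1 / δ)) := by
          gcongr
      _ = _ := by ring
  refine hupper.trans ?_
  rcases le_total N n with h | h
  · exact hN.trans (Nat.cast_le.2 h)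
  · have hnp : n * p ≤ δ := by
      have : (n : ℝ) ≤ N := Nat.cast_le.2 h
      nlinarith
    linarith [P.le_mul_samples hA hA2 hS hp hp' hε hε' hδ hδ' hL hnp code hn]

theorem mainTheorem4 :
    ∃ c : ℝ, 0 < c ∧
      ∀ (S A : ℕ) (Bs BT T ε δ : ℝ),
        1 ≤ Bs → 2 ≤ BT → Bs ≤ BT →
        BT ≤ Bs * ((A : ℝ) - 1) ^ ((S + 1) / 2 - 1) / 4 →
        6 * BT ≤ T →
        0 < ε → ε < 1 / 32 →
        0 < δ → δ < 1 / (8 * Real.exp 4) →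
        ∀ L : Learner S A, L.IsCorrect ε δ T →
          ∃ M : SSP S A,
            (∃ π, M.IsProper π) ∧
            M.cmin = 0 ∧
            M.Bstar = ENNReal.ofReal Bs ∧
            M.Tddagger = ∞ ∧
            ENNReal.ofReal (BT / 2) ≤ M.BstarT T ∧
            M.BstarT T ≤ ENNReal.ofReal (3 * BT) ∧
            ∀ n : ℕ, L.SampleComplexityLE M δ n →
              c * (T * (M.BstarT T).toReal ^ 2 * S * A / ε ^ 2 * Real.log (1 / δ)) ≤ n := by
  refine ⟨1 / 10240, by norm_num, ?_⟩
  intro S A Bs BT T ε δ hBs hBT hle hcode hT hε hε' hδ hδ' L hL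
  -- Since `Bs ≤ BT`, the lock must have at least four codes; this excludes an empty lock and fewer
  -- than two digits.
  have hpow : 4 ≤ ((A : ℝ) - 1) ^ ((S + 1) / 2 - 1) := by
    by_contra hlt
    nlinarith
  have hk : (S + 1) / 2 - 1 ≠ 0 := by
    intro h0
    rw [h0, pow_zero] at hpow
    linarith
  have hA3 : 3 ≤ A := by
    by_contra hlt
    have habs : |(A : ℝ) - 1| ≤ 1 := by
      have h1 : (A : ℝ) ≤ 2 := by exact_mod_cast (show A ≤ 2 by omega)
      have h2 : (0 : ℝ) ≤ A := Nat.cast_nonneg A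
      exact abs_le.2 ⟨by linarith, by linarith⟩
    have := (le_abs_self _).trans_eq (abs_pow ((A : ℝ) - 1) ((S + 1) / 2 - 1))
    linarith [pow_le_one₀ (n := (S + 1) / 2 - 1) (abs_nonneg _) habs]
  obtain ⟨A, rfl⟩ : ∃ A', A = A' + 1 := ⟨A - 1, by omega⟩
  rw [Nat.cast_add_one, add_sub_cancel_right] at hcode
  let P : LockParams S :=
    { k := (S + 1) / 2 - 1
      k_pos := by omega
      k_lt := by omega
      B := Bs
      BT := BT
      T := T
      one_le_B := hBs
      two_le_BT := hBT
      B_le_BT := hle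
      six_mul_BT_le_T := hT }
  obtain ⟨M, hproper, hcmin, hB, hlow, hup, hn⟩ := exists_hard_instance P
    (show 4 * BT ≤ Bs * (A : ℝ) ^ ((S + 1) / 2 - 1) by linarith) (by omega)
    (show S ≤ 3 * (S - 1 - ((S + 1) / 2 - 1)) by omega) hε
    (show ε ≤ BT / 16 by linarith) hδ hδ' L hL
  refine ⟨M, hproper, hcmin, hB, ?_, hlow, hup.trans (ENNReal.ofReal_le_ofReal ?_), hn⟩
  · rw [SSP.Tddagger, hcmin, hB, ENNReal.coe_zero, ENNReal.div_zero]
    exact (ENNReal.ofReal_pos.2 (by linarith)).ne'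
  · change 2 * BT ≤ 3 * BT
    linarith
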